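/- Let $n\ge 1$ and $B\in\mathbb{C}^{n\times n}$. Write $B_H=(B+B^*)/2$ and $B_A=(B-B^*)/2$ for its Hermitian and anti-Hermitian parts, and assume that $B$ is positive conservative-dissipative, i.e. $B_H\ge 0$. Call $B$ hypocoercive if its spectrum lies in the open right half plane. The hypocoercivity index $m_{HC}$ of $B$ is the smallest integer $m\ge 0$ such that $\sum_{j=0}^m B_A^j B_H (B_A^*)^j$ is positive definite ($m_{HC}=\infty$ if there is none). Put $\widetilde{\widetilde T}_m=\sum_{j=0}^m (B^*)^jB_HB^j$, and let $\|\cdot\|_2$ denote the spectral norm. (a) $B$ is hypocoercive if and only if there are real numbers $a,c,\varepsilon>0$ such that $$\|e^{-Bt}\|_2 = 1-c\,t^a+\mathcal{O}(t^{a+1})\qquad\text{for } t\in[0,\varepsilon),\tag{1}$$ i.e. $\big|\|e^{-Bt}\|_2-1+c\,t^a\big|\le M t^{a+1}$ on $[0,\varepsilon)$ for some constant $M$. Likewise, $m_{HC}$ is finite if and only if (1) holds for some $a,c,\varepsilon>0$. Whenever (1) holds with $a,c,\varepsilon>0$, necessarily $m_{HC}<\infty$ and $a=2m_{HC}+1$.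 (b) The constant $c$ in (1) is then determined by $B$: if $m:=m_{HC}\ge 1$, then $$c=\frac{1}{(2m+1)!\binom{2m}{m}}\min_{x\in\ker \widetilde{\widetilde T}_{m-1},\ \|x\|=1}\langle x,(B^*)^mB_HB^m x\rangle=\frac{1}{(2m+1)!\binom{2m}{m}}\min_{x\in\ker \widetilde{\widetilde T}_{m-1},\ \|x\|=1}\langle x,(B_A^*)^mB_HB_A^m x\rangle ,$$ where both minima are attained over a non-empty set; if $m_{HC}=0$, then $c=\min_{\|x\|=1}\langle x,B_Hx\rangle$. -/

import Mathlib

namespace Hypocoercivity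

open Matrix
open scoped ComplexOrder

/-- The Hermitian part `B_H = (B + B*) / 2` of a complex matrix. -/
noncomputable def hermPart {n : ℕ} (B : Matrix (Fin n) (Fin n) ℂ) : Matrix (Fin n) (Fin n) ℂ :=
  (1 / 2 : ℂ) • (B + Bᴴ)

/-- The anti-Hermitian part `B_A = (B - B*) / 2` of a complex matrix. -/
noncomputable def antiHermPart {n : ℕ} (B : Matrix (Fin n) (Fin n) ℂ) :
    Matrix (Fin n) (Fin n) ℂ :=
  (1 / 2 : ℂ) • (B - Bᴴ)

/-- `B` is positive conservative-dissipative: its Hermitian part is positive semi-definite. -/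
def IsPosConservativeDissipative {n : ℕ} (B : Matrix (Fin n) (Fin n) ℂ) : Prop :=
  (hermPart B).PosSemidef

/-- `B` is hypocoercive: its spectrum lies in the open right half plane. -/
def IsHypocoercive {n : ℕ} (B : Matrix (Fin n) (Fin n) ℂ) : Prop :=
  ∀ z ∈ spectrum ℂ B, 0 < z.re

/-- `T_m = ∑_{j=0}^m B_A^j B_H (B_A*)^j`. -/
noncomputable def T {n : ℕ} (B : Matrix (Fin n) (Fin n) ℂ) (m : ℕ) :
    Matrix (Fin n) (Fin n) ℂ :=
  ∑ j ∈ Finset.range (m + 1), antiHermPart B ^ j * hermPart B * ((antiHermPart B)ᴴ) ^ j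

/-- `∑_{j=0}^m (B*)^j B_H B^j`, the matrix written as `T` with a double tilde. -/
noncomputable def Ttt {n : ℕ} (B : Matrix (Fin n) (Fin n) ℂ) (m : ℕ) :
    Matrix (Fin n) (Fin n) ℂ :=
  ∑ j ∈ Finset.range (m + 1), (Bᴴ) ^ j * hermPart B * B ^ j

/-- The hypocoercivity index: the smallest `m` with `T_m` positive definite,
and `⊤` if there is no such `m`. -/
noncomputable def hcIndex {n : ℕ} (B : Matrix (Fin n) (Fin n) ℂ) : ℕ∞ :=
  ⨅ (m : ℕ) (_ : (T B m).PosDef), (m : ℕ∞)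

/-- The spectral norm (operator norm for the Euclidean norm) of `e^{-Bt}`. -/
noncomputable def propagatorNorm {n : ℕ} (B : Matrix (Fin n) (Fin n) ℂ) (t : ℝ) : ℝ :=
  ‖Matrix.toEuclideanCLM (n := Fin n) (𝕜 := ℂ) (NormedSpace.exp (-((t : ℂ) • B)))‖

/-- `‖e^{-Bt}‖₂ = 1 - c t^a + O(t^{a+1})` for `t ∈ [0, ε)`, for some `ε > 0`. -/
def HasShortTimeDecay {n : ℕ} (B : Matrix (Fin n) (Fin n) ℂ) (a c : ℝ) : Prop :=
  ∃ ε > (0 : ℝ), ∃ M : ℝ, ∀ t ∈ Set.Ico (0 : ℝ) ε,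
    |propagatorNorm B t - (1 - c * t ^ a)| ≤ M * t ^ (a + 1)

/-- `⟨x, M x⟩` as a real number (used for Hermitian `M`, where the inner product is real). -/
noncomputable def quadForm {n : ℕ} (M : Matrix (Fin n) (Fin n) ℂ)
    (x : EuclideanSpace ℂ (Fin n)) : ℝ :=
  (inner ℂ x (Matrix.toEuclideanLin M x)).re

/-- The set of unit vectors in the kernel of `M`. -/
def unitKer {n : ℕ} (M : Matrix (Fin n) (Fin n) ℂ) : Set (EuclideanSpace ℂ (Fin n)) :=
  {x | Matrix.toEuclideanLin M x = 0 ∧ ‖x‖ = 1}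

end Hypocoercivity

namespace Hypocoercivity

/-! Factor `B_H = C* C`. Then `‖e^{-Bt}x‖² = ‖x‖² - 2t ∫₀¹ ‖C e^{-Bts}x‖² ds`, so the decay of the
norm is governed by the least energy dissipated by a unit vector. To order `t^m` the integrand is
the squared norm of a polynomial in `s` with vector coefficients `(-t)^j/j! · C B^j x`. Among
polynomials of degree at most `m` with given leading coefficient `z`, the minimal squared
`L²(0,1)`-norm is `γ_m ‖z‖²`, attained by the monic shifted Legendre polynomial, with `γ_m =
1/((2m+1) binom(2m,m)²)`.

Let `K_m` be the common kernel of `C B^j`, `j < m`. Vectors away from `K_m` dissipate at a lower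
order in `t`, so only the minimum `μ` of `‖C B^m x‖²` over unit vectors of `K_m` matters. This gives
`‖e^{-Bt}‖² ≤ 1 - 2c t^(2m+1) + O(t^(2m+2))` with `c = γ_m μ / m!²` (`exists_norm_exp_sq_le`). The
reverse bound perturbs a minimiser `x` to `x + O(t)`, tuning the lower coefficients to the Legendre
ones (`exists_integral_le`, `exists_le_norm_exp_sq`).

On `ker C` the matrices `B` and `B_A` agree, so `K_m` and `B^m` restricted to it may be computed
with either (`pow_apply_eq_of_forall_lt`). Hence the index is the first `m` with `K_(m+1) = 0`, and
there `μ > 0`. Hypocoercivity forces the chain `K_m` to reach `0`, as otherwise some eigenvector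
lies in `ker C` and its eigenvalue is imaginary; conversely decay makes the propagator a strict
contraction at some time, which puts the spectrum in the right half plane. Uniqueness of the leading
term identifies `a` and `c`. -/

/-! ### Shifted Legendre polynomials and their extremal constant -/

open Polynomial in
theorem integral_mul_iterate_derivative (w : ℝ[X]) (m : ℕ)
    (h0 : ∀ i < m, (derivative^[i] w).eval 0 = 0) (h1 : ∀ i < m, (derivative^[i] w).eval 1 = 0)
    (g : ℝ[X]) :
    ∫ s in (0 : ℝ)..1, g.eval s * (derivative^[m] w).eval s =
      (-1) ^ m * ∫ s in (0 : ℝ)..1, (derivative^[m] g).eval s * w.eval s := by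
  induction m generalizing g with
  | zero => simp
  | succ m ih =>
    have hp := intervalIntegral.integral_mul_deriv_eq_deriv_mul (a := 0) (b := 1)
      (u := fun s => g.eval s) (v := fun s => (derivative^[m] w).eval s)
      (u' := fun s => (derivative g).eval s) (v' := fun s => (derivative^[m + 1] w).eval s)
      (fun s _ => g.hasDerivAt s)
      (fun s _ => by
        rw [Function.iterate_succ_apply']
        exact (derivative^[m] w).hasDerivAt s)
      ((Polynomial.continuous _).intervalIntegrable _ _)
      ((Polynomial.continuous _).intervalIntegrable _ _)
    rw [hp, h0 m (Nat.lt_succ_self m), h1 m (Nat.lt_succ_self m),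
      ih (fun i hi => h0 i (hi.trans (Nat.lt_succ_self m)))
        (fun i hi => h1 i (hi.trans (Nat.lt_succ_self m))) (derivative g),
      ← Function.iterate_succ_apply]
    ring

theorem integral_pow_mul_one_sub_pow (a b : ℕ) :
    ∫ s in (0 : ℝ)..1, s ^ a * (1 - s) ^ b =
      (a.factorial * b.factorial : ℝ) / (a + b + 1).factorial := by
  induction b generalizing a with
  | zero =>
    have := Nat.factorial_ne_zero a
    simp [Nat.factorial_succ]
    field_simp
  | succ b ih =>
    -- Integrating the derivative of `s^(a+1) (1-s)^(b+1)`, which vanishes at both ends, gives the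
    -- recursion for the Beta integral.
    have hd : ∫ s in (0 : ℝ)..1, ((a + 1 : ℝ) * (s ^ a * (1 - s) ^ (b + 1))
        - (b + 1 : ℝ) * (s ^ (a + 1) * (1 - s) ^ b)) = 0 := by
      rw [intervalIntegral.integral_eq_sub_of_hasDerivAt
        (f := fun s : ℝ => s ^ (a + 1) * (1 - s) ^ (b + 1))]
      · simp
      · intro s _
        have h1 := (hasDerivAt_pow (a + 1) s).mul
          (((hasDerivAt_id s).const_sub 1).pow (b + 1))
        refine (h1.congr_deriv ?_)
        simp only [Nat.add_sub_cancel, id, Pi.pow_apply]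
        push_cast
        ring
      · exact Continuous.intervalIntegrable (by fun_prop) _ _
    rw [intervalIntegral.integral_sub (Continuous.intervalIntegrable (by fun_prop) _ _)
      (Continuous.intervalIntegrable (by fun_prop) _ _), intervalIntegral.integral_const_mul,
      intervalIntegral.integral_const_mul, ih] at hd
    have ha : (a + 1 : ℝ) ≠ 0 := by positivity
    apply mul_left_cancel₀ ha
    rw [show a + (b + 1) + 1 = a + 1 + b + 1 by ring, Nat.factorial_succ b]
    rw [Nat.factorial_succ a] at hd
    push_cast at hd ⊢
    linear_combination hd

theorem eval_iterate_derivative_X_sub_C_pow_mul (q : Polynomial ℝ) (x : ℝ) {m i : ℕ}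
    (hi : i < m) :
    (Polynomial.derivative^[i] ((Polynomial.X - Polynomial.C x) ^ m * q)).eval x = 0 := by
  rcases eq_or_ne q 0 with rfl | hq
  · simp
  have hne : (Polynomial.X - Polynomial.C x) ^ m * q ≠ 0 :=
    mul_ne_zero (pow_ne_zero _ (Polynomial.X_sub_C_ne_zero x)) hq
  exact Polynomial.isRoot_iterate_derivative_of_lt_rootMultiplicity
    (lt_of_lt_of_le hi ((Polynomial.le_rootMultiplicity_iff hne).2 (dvd_mul_right _ _)))

/-- The squared `L²(0,1)`-norm of the monic shifted Legendre polynomial of degree `m`. -/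
noncomputable def legendreConst (m : ℕ) : ℝ := 1 / ((2 * m + 1) * ((2 * m).choose m : ℝ) ^ 2)

theorem legendreConst_pos (m : ℕ) : 0 < legendreConst m := by
  have : 0 < (2 * m).choose m := Nat.choose_pos (by omega)
  unfold legendreConst
  positivity

-- Rodrigues' formula writes `m!` times the polynomial as the `m`-th derivative of `s^m (1-s)^m`;
-- integration by parts then moves all derivatives onto `s^k`, which kills every `k < m`.
open Polynomial in
theorem integral_pow_mul_shiftedLegendre (m k : ℕ) :
    (m.factorial : ℝ) * ∫ s in (0 : ℝ)..1, s ^ k * aeval s (shiftedLegendre m) =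
      (-1) ^ m * ∫ s in (0 : ℝ)..1,
        (derivative^[m] (X ^ k : ℝ[X])).eval s * (s ^ m * (1 - s) ^ m) := by
  have hR := congrArg (Polynomial.map (Int.castRingHom ℝ)) (factorial_mul_shiftedLegendre_eq m)
  rw [← Polynomial.iterate_derivative_map] at hR
  simp only [Polynomial.map_mul, Polynomial.map_natCast, Polynomial.map_pow, Polynomial.map_sub,
    Polynomial.map_one, Polynomial.map_X] at hR
  have h := integral_mul_iterate_derivative (X ^ m * (1 - X) ^ m) m
    (fun i hi => by
      simpa using eval_iterate_derivative_X_sub_C_pow_mul ((1 - X) ^ m) 0 hi)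
    (fun i hi => by
      have e : (X ^ m * (1 - X) ^ m : ℝ[X]) = (X - C 1) ^ m * ((-1) ^ m * X ^ m) := by
        rw [show (1 - X : ℝ[X]) = (X - C 1) * (-1) by simp, mul_pow, mul_comm, mul_assoc]
      rw [e]
      exact eval_iterate_derivative_X_sub_C_pow_mul _ 1 hi)
    (X ^ k)
  rw [← intervalIntegral.integral_const_mul]
  have hw : ∀ s : ℝ, (X ^ m * (1 - X) ^ m : ℝ[X]).eval s = s ^ m * (1 - s) ^ m := by
    intro s; simp
  simp only [hw] at h
  rw [← h, ← hR]
  refine intervalIntegral.integral_congr fun s _ => ?_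
  simp only [eval_mul, eval_pow, eval_X, eval_natCast, aeval_def, eval_map]
  rw [mul_left_comm]
  rfl

open Polynomial in
theorem exists_monic_shiftedLegendre (m : ℕ) : ∃ L : ℝ[X], L.natDegree ≤ m ∧ L.coeff m = 1 ∧
    (∀ k < m, ∫ s in (0 : ℝ)..1, s ^ k * L.eval s = 0) ∧
    ∫ s in (0 : ℝ)..1, s ^ m * L.eval s = legendreConst m := by
  have hc : ((2 * m).choose m : ℝ) ≠ 0 := by
    exact_mod_cast (Nat.choose_pos (by omega)).ne'
  have hm : (m.factorial : ℝ) ≠ 0 := by exact_mod_cast m.factorial_ne_zero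
  have h2 : ((2 * m).choose m : ℝ) * m.factorial * m.factorial = (2 * m).factorial := by
    have := Nat.choose_mul_factorial_mul_factorial (show m ≤ 2 * m by omega)
    rw [show 2 * m - m = m by omega] at this
    exact_mod_cast this
  have hev : ∀ s : ℝ, (C ((-1) ^ m / ((2 * m).choose m : ℝ)) *
      (shiftedLegendre m).map (Int.castRingHom ℝ)).eval s =
      (-1) ^ m / ((2 * m).choose m : ℝ) * aeval s (shiftedLegendre m) := by
    intro s
    rw [eval_mul, eval_C, aeval_def, eval_map]
    rfl
  have hint : ∀ k, ∫ s in (0 : ℝ)..1, s ^ k * (C ((-1) ^ m / ((2 * m).choose m : ℝ)) *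
      (shiftedLegendre m).map (Int.castRingHom ℝ)).eval s =
      1 / (((2 * m).choose m : ℝ) * m.factorial) * ∫ s in (0 : ℝ)..1,
        (derivative^[m] (X ^ k : ℝ[X])).eval s * (s ^ m * (1 - s) ^ m) := by
    intro k
    simp only [hev, mul_left_comm _ ((-1) ^ m / ((2 * m).choose m : ℝ))]
    rw [intervalIntegral.integral_const_mul]
    apply mul_left_cancel₀ hm
    rw [mul_left_comm, integral_pow_mul_shiftedLegendre]
    field_simp
    rw [← pow_mul, mul_comm m 2, pow_mul]
    simp
  -- The leading coefficient of `shiftedLegendre m` is `(-1)^m binom(2m,m)`; the scalar makes the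
  -- polynomial monic.
  refine ⟨C ((-1) ^ m / ((2 * m).choose m : ℝ)) * (shiftedLegendre m).map (Int.castRingHom ℝ),
    ?_, ?_, ?_, ?_⟩
  · refine (natDegree_C_mul_le _ _).trans (natDegree_map_le.trans ?_)
    simp
  · rw [coeff_C_mul, coeff_map, coeff_shiftedLegendre, ← two_mul]
    simp only [Nat.choose_self, eq_intCast]
    push_cast
    field_simp
    rw [← pow_mul, mul_comm m 2, pow_mul]
    simp
  · intro k hk
    rw [hint, iterate_derivative_X_pow_eq_smul, Nat.descFactorial_eq_zero_iff_lt.2 hk]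
    simp
  · rw [hint, iterate_derivative_X_pow_eq_smul, Nat.descFactorial_self]
    simp only [Nat.sub_self, pow_zero, eval_smul, eval_one, smul_eq_mul, mul_one,
      intervalIntegral.integral_const_mul]
    rw [integral_pow_mul_one_sub_pow, legendreConst, ← two_mul, Nat.factorial_succ]
    push_cast
    rw [← h2]
    field_simp

theorem integral_eval_sq_eq {L : Polynomial ℝ} {m : ℕ} {γ : ℝ} (hdeg : L.natDegree ≤ m)
    (hlead : L.coeff m = 1) (horth : ∀ k < m, ∫ s in (0 : ℝ)..1, s ^ k * L.eval s = 0)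
    (hself : ∫ s in (0 : ℝ)..1, s ^ m * L.eval s = γ) :
    ∫ s in (0 : ℝ)..1, L.eval s ^ 2 = γ := by
  have h1 : ∀ s : ℝ, L.eval s ^ 2 =
      ∑ j ∈ Finset.range (m + 1), L.coeff j * (s ^ j * L.eval s) := by
    intro s
    rw [sq]
    conv_lhs => enter [1]; rw [Polynomial.eval_eq_sum_range' (Nat.lt_succ_of_le hdeg)]
    rw [Finset.sum_mul]
    simp only [mul_assoc]
  simp only [h1]
  rw [intervalIntegral.integral_finsetSum
    (fun j _ => Continuous.intervalIntegrable (by fun_prop) _ _), Finset.sum_range_succ,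
    Finset.sum_eq_zero, zero_add, intervalIntegral.integral_const_mul, hself, hlead, one_mul]
  intro j hj
  rw [intervalIntegral.integral_const_mul, horth j (Finset.mem_range.1 hj), mul_zero]

/-! ### Vector-valued polynomials in `L²(0,1)` -/

section VectorPolynomials

variable {E : Type*} [NormedAddCommGroup E] [InnerProductSpace ℂ E]

/-- Among the vector polynomials of degree at most `m` with prescribed leading coefficient, the
multiple of the shifted Legendre polynomial has the smallest `L²(0,1)`-norm. -/
theorem legendreConst_mul_le_integral (m : ℕ) (z : ℕ → E) :
    legendreConst m * ‖z m‖ ^ 2 ≤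
      ∫ s in (0 : ℝ)..1, ‖∑ j ∈ Finset.range (m + 1), s ^ j • z j‖ ^ 2 := by
  obtain ⟨L, hdeg, hlead, horth, hself⟩ := exists_monic_shiftedLegendre m
  have hLL := integral_eval_sq_eq hdeg hlead horth hself
  have hLp : ∫ s in (0 : ℝ)..1,
      L.eval s * (inner ℂ (∑ j ∈ Finset.range (m + 1), s ^ j • z j) (z m)).re =
      legendreConst m * ‖z m‖ ^ 2 := by
    have h1 : ∀ s : ℝ, L.eval s * (inner ℂ (∑ j ∈ Finset.range (m + 1), s ^ j • z j) (z m)).re =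
        ∑ j ∈ Finset.range (m + 1), (inner ℂ (z j) (z m)).re * (s ^ j * L.eval s) := by
      intro s
      rw [sum_inner, Complex.re_sum, Finset.mul_sum]
      refine Finset.sum_congr rfl fun j _ => ?_
      rw [← Complex.coe_smul, inner_smul_left]
      simp only [Complex.conj_ofReal, Complex.re_ofReal_mul]
      ring
    simp only [h1]
    rw [intervalIntegral.integral_finsetSum
      (fun j _ => Continuous.intervalIntegrable (by fun_prop) _ _), Finset.sum_range_succ,
      Finset.sum_eq_zero, zero_add, intervalIntegral.integral_const_mul, hself, mul_comm]
    · congr 1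
      rw [← inner_self_eq_norm_sq (𝕜 := ℂ)]
      rfl
    · intro j hj
      rw [intervalIntegral.integral_const_mul, horth j (Finset.mem_range.1 hj), mul_zero]
  -- Subtracting `L z_m` leaves a nonnegative quantity; orthogonality makes both the cross integral
  -- and the square equal to `γ ‖z_m‖²`, so expanding gives the bound.
  have hnn : 0 ≤ ∫ s in (0 : ℝ)..1,
      ‖(∑ j ∈ Finset.range (m + 1), s ^ j • z j) - L.eval s • z m‖ ^ 2 :=
    intervalIntegral.integral_nonneg zero_le_one fun s _ => by positivity
  have hexp : ∀ s : ℝ, ‖(∑ j ∈ Finset.range (m + 1), s ^ j • z j) - L.eval s • z m‖ ^ 2 =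
      ‖∑ j ∈ Finset.range (m + 1), s ^ j • z j‖ ^ 2
      - 2 * (L.eval s * (inner ℂ (∑ j ∈ Finset.range (m + 1), s ^ j • z j) (z m)).re)
      + L.eval s ^ 2 * ‖z m‖ ^ 2 := by
    intro s
    rw [@norm_sub_sq ℂ, norm_smul, ← Complex.coe_smul, inner_smul_right]
    simp only [RCLike.re_to_complex, Complex.re_ofReal_mul, Real.norm_eq_abs, mul_pow, sq_abs]
  simp only [hexp] at hnn
  rw [intervalIntegral.integral_add (Continuous.intervalIntegrable (by fun_prop) _ _)
    (Continuous.intervalIntegrable (by fun_prop) _ _), intervalIntegral.integral_sub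
    (Continuous.intervalIntegrable (by fun_prop) _ _)
    (Continuous.intervalIntegrable (by fun_prop) _ _), intervalIntegral.integral_const_mul,
    intervalIntegral.integral_mul_const, hLL, hLp] at hnn
  linarith

/-- The `L²(0,1)`-norm controls the coefficients of a vector polynomial. -/
theorem exists_mul_sum_norm_sq_le_integral (m : ℕ) : ∃ κ > (0 : ℝ), ∀ z : ℕ → E,
    κ * ∑ j ∈ Finset.range m, ‖z j‖ ^ 2 ≤
      ∫ s in (0 : ℝ)..1, ‖∑ j ∈ Finset.range m, s ^ j • z j‖ ^ 2 := by
  induction m with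
  | zero => exact ⟨1, one_pos, fun z => by simp⟩
  | succ m ih =>
    obtain ⟨κ, hκ, h⟩ := ih
    have hγ := legendreConst_pos m
    set γ := legendreConst m
    -- With `I` the integral, `‖z_m‖² ≤ I/γ` by the Legendre bound. Removing the leading term leaves
    -- an integral of at most `2I + 2‖z_m‖²`, to which the induction hypothesis applies; the
    -- constant adds up the two estimates.
    refine ⟨1 / (2 / κ * (1 + 1 / γ) + 1 / γ), by positivity, fun z => ?_⟩
    have h1 := legendreConst_mul_le_integral m z
    have h2 : ∫ s in (0 : ℝ)..1, ‖∑ j ∈ Finset.range m, s ^ j • z j‖ ^ 2 ≤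
        ∫ s in (0 : ℝ)..1, (2 * ‖∑ j ∈ Finset.range (m + 1), s ^ j • z j‖ ^ 2
          + 2 * ‖z m‖ ^ 2) := by
      refine intervalIntegral.integral_mono_on zero_le_one
        (Continuous.intervalIntegrable (by fun_prop) _ _)
        (Continuous.intervalIntegrable (by fun_prop) _ _) fun s hs => ?_
      have e : ∑ j ∈ Finset.range m, s ^ j • z j =
          (∑ j ∈ Finset.range (m + 1), s ^ j • z j) - s ^ m • z m := by
        rw [Finset.sum_range_succ]; abel
      have hs1 : ‖s ^ m • z m‖ ≤ ‖z m‖ := by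
        rw [norm_smul, norm_pow, Real.norm_of_nonneg hs.1]
        exact mul_le_of_le_one_left (norm_nonneg _) (pow_le_one₀ hs.1 hs.2)
      have h3 : ‖∑ j ∈ Finset.range m, s ^ j • z j‖ ≤
          ‖∑ j ∈ Finset.range (m + 1), s ^ j • z j‖ + ‖z m‖ := by
        rw [e]
        exact (norm_sub_le _ _).trans (by gcongr)
      refine (pow_le_pow_left₀ (norm_nonneg _) h3 2).trans ?_
      nlinarith [sq_nonneg (‖∑ j ∈ Finset.range (m + 1), s ^ j • z j‖ - ‖z m‖)]
    rw [intervalIntegral.integral_add (Continuous.intervalIntegrable (by fun_prop) _ _)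
      (Continuous.intervalIntegrable (by fun_prop) _ _), intervalIntegral.integral_const_mul]
      at h2
    simp only [intervalIntegral.integral_const, sub_zero, one_smul] at h2
    have h4 := (h z).trans h2
    rw [Finset.sum_range_succ, one_div_mul_eq_div, div_le_iff₀ (by positivity)]
    generalize (∫ s in (0 : ℝ)..1, ‖∑ j ∈ Finset.range (m + 1), s ^ j • z j‖ ^ 2) = I at *
    have h5 : ‖z m‖ ^ 2 ≤ I * (1 / γ) := by
      rw [mul_one_div, le_div_iff₀ hγ]; linarith
    have h6 : ∑ j ∈ Finset.range m, ‖z j‖ ^ 2 ≤ I * (2 / κ * (1 + 1 / γ)) := by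
      have : ∑ j ∈ Finset.range m, ‖z j‖ ^ 2 ≤ (2 * I + 2 * (I * (1 / γ))) / κ := by
        rw [le_div_iff₀ hκ]; linarith
      refine this.trans_eq ?_
      ring
    linarith

end VectorPolynomials

/-! ### Energy identity and Taylor expansion of the semigroup -/

section Semigroup

variable {E : Type*} [NormedAddCommGroup E] [InnerProductSpace ℂ E] [FiniteDimensional ℂ E]

theorem hasDerivAt_exp_neg_smul_apply (B : E →L[ℂ] E) (x : E) (t : ℝ) :
    HasDerivAt (fun s : ℝ => NormedSpace.exp (-(s • B)) x)
      (-(B (NormedSpace.exp (-(t • B)) x))) t := by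
  have : CompleteSpace E := FiniteDimensional.complete ℂ E
  have h := hasDerivAt_exp_smul_const' (𝕂 := ℝ) (-B) t
  simp only [smul_neg] at h
  have h2 := ((ContinuousLinearMap.apply ℂ E x).restrictScalars ℝ).hasFDerivAt.comp_hasDerivAt t h
  refine (h2.congr_deriv ?_)
  simp

theorem continuous_exp_neg_smul_apply (B : E →L[ℂ] E) (x : E) :
    Continuous fun s : ℝ => NormedSpace.exp (-(s • B)) x :=
  continuous_iff_continuousAt.2 fun t => (hasDerivAt_exp_neg_smul_apply B x t).continuousAt

/-- The energy balance integrated over `[0,t]` and rescaled to `[0,1]`, where the Legendre bound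
applies. -/
theorem norm_exp_neg_smul_apply_sq {B C : E →L[ℂ] E}
    (hBC : ∀ x, (inner ℂ x (B x)).re = ‖C x‖ ^ 2) (x : E) (t : ℝ) :
    ‖NormedSpace.exp (-(t • B)) x‖ ^ 2 = ‖x‖ ^ 2 -
      2 * t * ∫ s in (0 : ℝ)..1, ‖C (NormedSpace.exp (-((t * s) • B)) x)‖ ^ 2 := by
  have hcont : Continuous fun s : ℝ => NormedSpace.exp (-((t * s) • B)) x :=
    (continuous_exp_neg_smul_apply B x).comp (continuous_const_mul t)
  have hd : ∀ s : ℝ, HasDerivAt (fun s : ℝ => ‖NormedSpace.exp (-((t * s) • B)) x‖ ^ 2)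
      (-2 * t * ‖C (NormedSpace.exp (-((t * s) • B)) x)‖ ^ 2) s := by
    intro s
    have h1 : HasDerivAt (fun s : ℝ => t * s) t s := by
      simpa using (hasDerivAt_id s).const_mul t
    have h2 := (hasDerivAt_exp_neg_smul_apply B x (t * s)).scomp s h1
    let : InnerProductSpace ℝ E := InnerProductSpace.complexToReal
    have h3 := h2.norm_sq
    refine h3.congr_deriv ?_
    rw [← hBC]
    simp only [Function.comp, real_inner_eq_re_inner ℂ, RCLike.re_to_complex]
    rw [inner_smul_right_eq_smul]
    simp
    ring
  have h := intervalIntegral.integral_eq_sub_of_hasDerivAt (a := 0) (b := 1)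
    (fun s _ => hd s)
    (((C.continuous.comp hcont).norm.pow 2).const_mul (-2 * t) |>.intervalIntegrable _ _)
  rw [intervalIntegral.integral_const_mul] at h
  simp only [mul_one, mul_zero, zero_smul, neg_zero, NormedSpace.exp_zero,
    one_apply_eq_self] at h
  linarith

theorem exists_norm_exp_sub_sum_le (B C : E →L[ℂ] E) (m : ℕ) :
    ∃ δ > (0 : ℝ), ∃ K ≥ (0 : ℝ), ∀ s : ℝ, 0 ≤ s → s < δ → ∀ x : E,
      ‖C (NormedSpace.exp (-(s • B)) x) -
        ∑ j ∈ Finset.range (m + 1), s ^ j • (((-1) ^ j / j.factorial : ℝ) • C ((B ^ j) x))‖ ≤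
      K * s ^ (m + 1) * ‖x‖ := by
  have : CompleteSpace E := FiniteDimensional.complete ℂ E
  have h := (NormedSpace.exp_hasFPowerSeriesAt_zero (𝕂 := ℝ)
    (𝔸 := E →L[ℂ] E)).isBigO_sub_partialSum_pow (m + 1)
  obtain ⟨K, hK, h⟩ := h.exists_nonneg
  rw [Asymptotics.isBigOWith_iff, Metric.eventually_nhds_iff] at h
  obtain ⟨r, hr, h⟩ := h
  -- This radius keeps `‖s • B‖ < r`; the `+ 1` covers `B = 0`.
  refine ⟨r / (‖B‖ + 1), by positivity, ‖C‖ * (K * ‖B‖ ^ (m + 1)), by positivity,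
    fun s hs0 hs x => ?_⟩
  have hn : ‖-(s • B)‖ = s * ‖B‖ := by rw [norm_neg, norm_smul, Real.norm_of_nonneg hs0]
  have h1 := h (y := -(s • B)) (by
    rw [dist_zero_right, hn]
    rw [lt_div_iff₀ (by positivity)] at hs
    nlinarith [norm_nonneg B])
  rw [zero_add, FormalMultilinearSeries.partialSum] at h1
  simp only [NormedSpace.expSeries_apply_eq, norm_pow, hn] at h1
  rw [Real.norm_of_nonneg (by positivity : 0 ≤ s * ‖B‖)] at h1
  have e : C (NormedSpace.exp (-(s • B)) x) -
      ∑ j ∈ Finset.range (m + 1), s ^ j • (((-1) ^ j / j.factorial : ℝ) • C ((B ^ j) x)) =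
      C ((NormedSpace.exp (-(s • B)) -
        ∑ j ∈ Finset.range (m + 1), ((j.factorial : ℝ)⁻¹ • (-(s • B)) ^ j)) x) := by
    rw [sub_apply, map_sub, sum_apply, map_sum]
    congr 1
    refine Finset.sum_congr rfl fun j _ => ?_
    rw [← neg_smul, smul_pow, smul_apply, smul_apply,
      smul_smul, smul_smul, ← Complex.coe_smul, ← Complex.coe_smul, map_smul]
    congr 2
    rw [neg_pow]
    ring
  rw [e]
  calc _ ≤ ‖C‖ * (K * (s * ‖B‖) ^ (m + 1) * ‖x‖) :=
        (C.le_opNorm _).trans (mul_le_mul_of_nonneg_left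
          ((ContinuousLinearMap.le_opNorm _ _).trans
            (mul_le_mul_of_nonneg_right h1 (norm_nonneg _))) (norm_nonneg _))
    _ = _ := by rw [mul_pow]; ring

end Semigroup

/-! ### Lower bound for the dissipated energy -/

section Expansion

variable {E : Type*} [NormedAddCommGroup E] [InnerProductSpace ℂ E]

/-- The common kernel of `C`, `C B`, …, `C B ^ (m - 1)`. -/
noncomputable def obsKer (B C : E →L[ℂ] E) (m : ℕ) : Submodule ℂ E :=
  ⨅ j ∈ Finset.range m, LinearMap.ker (C ∘L B ^ j).toLinearMap

theorem mem_obsKer {B C : E →L[ℂ] E} {m : ℕ} {x : E} :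
    x ∈ obsKer B C m ↔ ∀ j < m, C ((B ^ j) x) = 0 := by
  simp only [obsKer, Submodule.mem_iInf, Finset.mem_range, LinearMap.mem_ker]
  rfl

/-- Young's inequality with weight `τ`. Taking `τ` of order `t` later makes the relative loss in the
main term of order `t`. -/
theorem mul_norm_sq_sub_le_norm_add_sq {F : Type*} [SeminormedAddCommGroup F] (a b : F) {τ : ℝ} (hτ : 0 < τ) :
    (1 - τ) * ‖a‖ ^ 2 - 1 / τ * ‖b‖ ^ 2 ≤ ‖a + b‖ ^ 2 := by
  have h1 : ‖a‖ ≤ ‖a + b‖ + ‖b‖ := by simpa using norm_sub_le (a + b) b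
  have h2 := pow_le_pow_left₀ (norm_nonneg a) h1 2
  rcases le_or_gt 1 τ with h | h
  · have : 0 ≤ 1 / τ * ‖b‖ ^ 2 := by positivity
    nlinarith [sq_nonneg ‖a‖, sq_nonneg ‖a + b‖]
  · have e : ‖a + b‖ ^ 2 - ((1 - τ) * (‖a + b‖ + ‖b‖) ^ 2 - 1 / τ * ‖b‖ ^ 2) =
        (τ * ‖a + b‖ - (1 - τ) * ‖b‖) ^ 2 / τ + ‖b‖ ^ 2 := by
      field_simp
      ring
    have : 0 ≤ (τ * ‖a + b‖ - (1 - τ) * ‖b‖) ^ 2 / τ := by positivity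
    have := mul_le_mul_of_nonneg_left h2 (sub_nonneg.2 h.le)
    nlinarith [sq_nonneg ‖b‖]

variable [FiniteDimensional ℂ E]

/-- The map `v ↦ (C B^j v)_{j<m}` is injective on the orthogonal complement of its kernel, hence
bounded below in finite dimension. -/
theorem exists_mul_norm_sq_le_sum_of_mem_orthogonal (B C : E →L[ℂ] E) (m : ℕ) :
    ∃ δ > (0 : ℝ), ∀ v ∈ (obsKer B C m)ᗮ,
      δ * ‖v‖ ^ 2 ≤ ∑ j ∈ Finset.range m, ‖C ((B ^ j) v)‖ ^ 2 := by
  let f : (obsKer B C m)ᗮ →ₗ[ℂ] (Fin m → E) :=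
    (LinearMap.pi fun j : Fin m => (C ∘L B ^ (j : ℕ)).toLinearMap) ∘ₗ (obsKer B C m)ᗮ.subtype
  have hf : LinearMap.ker f = ⊥ := by
    rw [LinearMap.ker_eq_bot']
    rintro ⟨v, hv⟩ h
    have hv' : v ∈ obsKer B C m := mem_obsKer.2 fun j hj => congrFun h ⟨j, hj⟩
    have := Submodule.inner_right_of_mem_orthogonal hv' hv
    simpa using this
  obtain ⟨K, hK, h⟩ := f.exists_antilipschitzWith hf
  refine ⟨1 / (K : ℝ) ^ 2, by positivity, fun v hv => ?_⟩
  have h1 : ‖v‖ ≤ K * ‖f ⟨v, hv⟩‖ := by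
    simpa [dist_eq_norm] using h.le_mul_dist ⟨v, hv⟩ 0
  have h2 : ‖f ⟨v, hv⟩‖ ≤ √(∑ j ∈ Finset.range m, ‖C ((B ^ j) v)‖ ^ 2) := by
    refine (pi_norm_le_iff_of_nonneg (Real.sqrt_nonneg _)).2 fun j => Real.le_sqrt_of_sq_le ?_
    exact Finset.single_le_sum (f := fun j => ‖C ((B ^ j) v)‖ ^ 2) (fun i _ => by positivity)
      (Finset.mem_range.2 j.2)
  have h3 : ‖f ⟨v, hv⟩‖ ^ 2 ≤ ∑ j ∈ Finset.range m, ‖C ((B ^ j) v)‖ ^ 2 := by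
    refine (pow_le_pow_left₀ (norm_nonneg _) h2 2).trans_eq (Real.sq_sqrt ?_)
    positivity
  have h4 := pow_le_pow_left₀ (norm_nonneg v) h1 2
  rw [mul_pow] at h4
  rw [one_div_mul_eq_div, div_le_iff₀ (by positivity)]
  nlinarith [sq_nonneg (K : ℝ)]

/-- Split `x = u + v` along `obsKer B C m`: the hypothesis handles `u`, while `v` and the mixed
terms are absorbed by the lower-order terms at the price `Λ / τ`. -/
theorem exists_mul_norm_sq_le_add_sum (B C : E →L[ℂ] E) (m : ℕ) {μ : ℝ} (hμ0 : 0 ≤ μ)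
    (hμ : ∀ u ∈ obsKer B C m, μ * ‖u‖ ^ 2 ≤ ‖C ((B ^ m) u)‖ ^ 2) :
    ∃ Λ > (0 : ℝ), ∀ τ, 0 < τ → τ ≤ 1 → ∀ x, (1 - τ) * μ * ‖x‖ ^ 2 ≤
      ‖C ((B ^ m) x)‖ ^ 2 + Λ / τ * ∑ j ∈ Finset.range m, ‖C ((B ^ j) x)‖ ^ 2 := by
  obtain ⟨δ, hδ, h⟩ := exists_mul_norm_sq_le_sum_of_mem_orthogonal B C m
  set N := ‖C ∘L B ^ m‖
  refine ⟨(N ^ 2 + μ + 1) / δ, by positivity, fun τ hτ hτ1 x => ?_⟩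
  obtain ⟨u, hu, v, hv, rfl⟩ := (obsKer B C m).exists_add_mem_mem_orthogonal x
  have hS : ∑ j ∈ Finset.range m, ‖C ((B ^ j) (u + v))‖ ^ 2 =
      ∑ j ∈ Finset.range m, ‖C ((B ^ j) v)‖ ^ 2 := by
    refine Finset.sum_congr rfl fun j hj => ?_
    rw [map_add, map_add, mem_obsKer.1 hu j (Finset.mem_range.1 hj), zero_add]
  have hN : ‖C ((B ^ m) v)‖ ≤ N * ‖v‖ := (C ∘L B ^ m).le_opNorm v
  have hN2 := pow_le_pow_left₀ (norm_nonneg _) hN 2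
  have h1 := mul_norm_sq_sub_le_norm_add_sq (C ((B ^ m) u)) (C ((B ^ m) v)) hτ
  have hnorm : ‖u + v‖ ^ 2 = ‖u‖ ^ 2 + ‖v‖ ^ 2 := by
    have := norm_add_sq_eq_norm_sq_add_norm_sq_of_inner_eq_zero (𝕜 := ℂ) u v
      (Submodule.inner_right_of_mem_orthogonal hu hv)
    nlinarith
  rw [hS, hnorm, map_add, map_add]
  have h2 := mul_le_mul_of_nonneg_left (h v hv) (show 0 ≤ (N ^ 2 + μ + 1) / δ / τ by positivity)
  have h3 : (N ^ 2 + μ + 1) / δ / τ * (δ * ‖v‖ ^ 2) = 1 / τ * ((N ^ 2 + μ + 1) * ‖v‖ ^ 2) := by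
    field_simp
  have h4 := mul_le_mul_of_nonneg_left (hμ u hu) (sub_nonneg.2 hτ1)
  have h5 : (1 - τ) * μ * ‖v‖ ^ 2 ≤ 1 / τ * ((μ + 1) * ‖v‖ ^ 2) := by
    have : 1 ≤ 1 / τ := by rw [le_div_iff₀ hτ]; linarith
    have h6 : 0 ≤ (μ + 1) * ‖v‖ ^ 2 := by positivity
    have h7 : (1 - τ) * μ * ‖v‖ ^ 2 ≤ (μ + 1) * ‖v‖ ^ 2 := by
      gcongr
      nlinarith
    nlinarith
  have h8 := mul_le_mul_of_nonneg_left hN2 (show 0 ≤ 1 / τ by positivity)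
  rw [mul_pow] at h8
  nlinarith

/-- The integral is split with weights `1 - t` and `t`. The first share gives the sharp Legendre
bound on the leading coefficient; the second controls the lower coefficients, which are larger by at
least `t^(-2)` when squared and so pay for the `Λ / τ` term. -/
theorem exists_le_integral_vectorPolynomial (B C : E →L[ℂ] E) (m : ℕ) {μ : ℝ} (hμ0 : 0 ≤ μ)
    (hμ : ∀ u ∈ obsKer B C m, μ * ‖u‖ ^ 2 ≤ ‖C ((B ^ m) u)‖ ^ 2) :
    ∃ β > (0 : ℝ), ∀ t, 0 < t → t ≤ 1 → β * t ≤ 1 → ∀ x,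
      t ^ (2 * m) * ((1 - t) * (1 - β * t) * (legendreConst m / m.factorial ^ 2 * μ)) * ‖x‖ ^ 2 ≤
      ∫ s in (0 : ℝ)..1, ‖∑ j ∈ Finset.range (m + 1), s ^ j • (t ^ j •
        (((-1) ^ j / j.factorial : ℝ) • C ((B ^ j) x)))‖ ^ 2 := by
  obtain ⟨κ, hκ, hk⟩ := exists_mul_sum_norm_sq_le_integral (E := E) (m + 1)
  obtain ⟨Λ, hΛ, hl⟩ := exists_mul_norm_sq_le_add_sum B C m hμ0 hμ
  have hγ := legendreConst_pos m
  set γ := legendreConst m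
  -- With `τ = β t`, this `β` makes `γ Λ / τ = κ / t`, so the two shares match.
  refine ⟨Λ * γ / κ, by positivity, fun t ht ht1 hβ x => ?_⟩
  set z : ℕ → E := fun j => t ^ j • (((-1) ^ j / j.factorial : ℝ) • C ((B ^ j) x)) with hz
  have hzn : ∀ j, ‖z j‖ ^ 2 = t ^ (2 * j) * (‖C ((B ^ j) x)‖ ^ 2 / (j.factorial : ℝ) ^ 2) := by
    intro j
    simp only [hz, norm_smul, norm_pow, norm_div, norm_neg, norm_one, one_pow,
      Real.norm_of_nonneg ht.le, RCLike.norm_natCast]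
    ring
  have h1 := legendreConst_mul_le_integral m z
  have h2 := hk z
  have h3 := hl (Λ * γ / κ * t) (by positivity) hβ x
  change _ ≤ ∫ s in (0 : ℝ)..1, ‖∑ j ∈ Finset.range (m + 1), s ^ j • z j‖ ^ 2
  set I := ∫ s in (0 : ℝ)..1, ‖∑ j ∈ Finset.range (m + 1), s ^ j • z j‖ ^ 2
  rw [hzn] at h1
  set S := ∑ j ∈ Finset.range m, ‖C ((B ^ j) x)‖ ^ 2 with hS
  have hm : (0 : ℝ) < m.factorial := by exact_mod_cast m.factorial_pos
  have h4 : t ^ (2 * m) * S / (m.factorial : ℝ) ^ 2 ≤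
      t ^ 2 * ∑ j ∈ Finset.range (m + 1), ‖z j‖ ^ 2 := by
    rw [Finset.sum_range_succ, hS, Finset.mul_sum, Finset.sum_div, mul_add, Finset.mul_sum]
    refine le_add_of_le_of_nonneg (Finset.sum_le_sum fun j hj => ?_) (by positivity)
    have hj := Finset.mem_range.1 hj
    rw [hzn, mul_div_assoc, ← mul_assoc, ← pow_add]
    have h5 : t ^ (2 * m) ≤ t ^ (2 + 2 * j) := by
      apply pow_le_pow_of_le_one ht.le ht1; omega
    have h6 : (j.factorial : ℝ) ≤ m.factorial := by exact_mod_cast Nat.factorial_le hj.le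
    gcongr
  have h7 : t ^ (2 * m) * (κ / t * S / (m.factorial : ℝ) ^ 2) ≤ t * I := by
    have := mul_le_mul_of_nonneg_left h4 hκ.le
    have h8 := mul_le_mul_of_nonneg_left h2 (sq_nonneg t)
    have h9 : t ^ (2 * m) * (κ / t * S / (m.factorial : ℝ) ^ 2) =
      κ * (t ^ (2 * m) * S / (m.factorial : ℝ) ^ 2) / t := by
      field_simp
    rw [h9, div_le_iff₀ ht]
    nlinarith
  have h10 := mul_le_mul_of_nonneg_left h3
    (show 0 ≤ t ^ (2 * m) * ((1 - t) * (γ / (m.factorial : ℝ) ^ 2)) by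
      have := sub_nonneg.2 ht1
      positivity)
  have h11 := mul_le_mul_of_nonneg_left h1 (sub_nonneg.2 ht1)
  have h12 : t ^ (2 * m) * ((1 - t) * (γ / (m.factorial : ℝ) ^ 2)) * (Λ / (Λ * γ / κ * t) * S) ≤
      t ^ (2 * m) * (κ / t * S / (m.factorial : ℝ) ^ 2) := by
    have h13 : t ^ (2 * m) * ((1 - t) * (γ / (m.factorial : ℝ) ^ 2)) *
        (Λ / (Λ * γ / κ * t) * S) =
        (1 - t) * (t ^ (2 * m) * (κ / t * S / (m.factorial : ℝ) ^ 2)) := by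
      field_simp
    rw [h13]
    exact mul_le_of_le_one_left (by positivity) (by linarith)
  calc _ = t ^ (2 * m) * ((1 - t) * (γ / (m.factorial : ℝ) ^ 2)) *
        ((1 - Λ * γ / κ * t) * μ * ‖x‖ ^ 2) := by ring
    _ ≤ _ := h10
    _ = (1 - t) * (γ * (t ^ (2 * m) * (‖C ((B ^ m) x)‖ ^ 2 / (m.factorial : ℝ) ^ 2))) +
        t ^ (2 * m) * ((1 - t) * (γ / (m.factorial : ℝ) ^ 2)) * (Λ / (Λ * γ / κ * t) * S) := by
      ring
    _ ≤ (1 - t) * I + t * I := add_le_add h11 (h12.trans h7)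
    _ = I := by ring

end Expansion

/-! ### Matching bounds for the propagator norm -/

section Expansion

variable {E : Type*} [NormedAddCommGroup E] [InnerProductSpace ℂ E] [FiniteDimensional ℂ E]

theorem exists_norm_exp_sq_le {B C : E →L[ℂ] E} (hBC : ∀ x, (inner ℂ x (B x)).re = ‖C x‖ ^ 2)
    (m : ℕ) {μ : ℝ} (hμ0 : 0 ≤ μ)
    (hμ : ∀ u ∈ obsKer B C m, μ * ‖u‖ ^ 2 ≤ ‖C ((B ^ m) u)‖ ^ 2) :
    ∃ ε > (0 : ℝ), ∃ M : ℝ, ∀ t, 0 < t → t < ε → ∀ x,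
      ‖NormedSpace.exp (-(t • B)) x‖ ^ 2 ≤
        (1 - 2 * (legendreConst m / m.factorial ^ 2 * μ) * t ^ (2 * m + 1) +
          M * t ^ (2 * m + 2)) * ‖x‖ ^ 2 := by
  obtain ⟨β, hβ, hlow⟩ := exists_le_integral_vectorPolynomial B C m hμ0 hμ
  obtain ⟨δ, hδ, K, hK, htay⟩ := exists_norm_exp_sub_sum_le B C m
  have hc0 : 0 ≤ legendreConst m / (m.factorial : ℝ) ^ 2 * μ := by
    have := legendreConst_pos m
    positivity
  set c := legendreConst m / (m.factorial : ℝ) ^ 2 * μ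
  refine ⟨min 1 (min (1 / β) δ), by positivity, 2 * ((2 + β) * c + K ^ 2),
    fun t ht htε x => ?_⟩
  have ht1 : t ≤ 1 := (htε.trans_le (min_le_left _ _)).le
  have htβ : β * t ≤ 1 := by
    have := (htε.trans_le ((min_le_right _ _).trans (min_le_left _ _))).le
    rw [le_div_iff₀ hβ] at this
    linarith
  have htδ : t < δ := htε.trans_le ((min_le_right _ _).trans (min_le_right _ _))
  rw [norm_exp_neg_smul_apply_sq hBC x t]
  have h1 := hlow t ht ht1 htβ x
  set p : ℝ → E := fun s => ∑ j ∈ Finset.range (m + 1), s ^ j • (t ^ j •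
        (((-1) ^ j / j.factorial : ℝ) • C ((B ^ j) x))) with hp
  have hpc : Continuous p := by
    simp only [hp]
    fun_prop
  have hfc : Continuous fun s : ℝ => C (NormedSpace.exp (-((t * s) • B)) x) :=
    C.continuous.comp ((continuous_exp_neg_smul_apply B x).comp (continuous_const_mul t))
  have h2 : ∫ s in (0 : ℝ)..1, ((1 - t) * ‖p s‖ ^ 2 - K ^ 2 * t ^ (2 * m + 1) * ‖x‖ ^ 2) ≤
      ∫ s in (0 : ℝ)..1, ‖C (NormedSpace.exp (-((t * s) • B)) x)‖ ^ 2 := by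
    refine intervalIntegral.integral_mono_on zero_le_one
      ((((hpc.norm.pow 2).const_mul (1 - t)).sub continuous_const).intervalIntegrable _ _)
      ((hfc.norm.pow 2).intervalIntegrable _ _) fun s hs => ?_
    have hts : t * s ≤ t := mul_le_of_le_one_right ht.le hs.2
    have hr := htay (t * s) (mul_nonneg ht.le hs.1) (hts.trans_lt htδ) x
    have e : ∑ j ∈ Finset.range (m + 1), (t * s) ^ j •
        (((-1) ^ j / j.factorial : ℝ) • C ((B ^ j) x)) = p s := by
      simp only [hp]
      refine Finset.sum_congr rfl fun j _ => ?_
      rw [mul_comm t s, mul_pow, mul_smul]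
    rw [e] at hr
    -- With weight `τ = t`, the remainder costs `(K t^(m+1))² / t`, one order beyond the main term
    -- `t^(2m)`.
    have h3 := mul_norm_sq_sub_le_norm_add_sq (p s)
      (C (NormedSpace.exp (-((t * s) • B)) x) - p s) ht
    rw [add_sub_cancel] at h3
    have hr' : ‖C (NormedSpace.exp (-((t * s) • B)) x) - p s‖ ≤ K * t ^ (m + 1) * ‖x‖ := by
      refine hr.trans ?_
      have := mul_nonneg ht.le hs.1
      gcongr
    have h4 := pow_le_pow_left₀ (norm_nonneg _) hr' 2
    have h5 := mul_le_mul_of_nonneg_left h4 (show 0 ≤ 1 / t by positivity)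
    have h6 : 1 / t * (K * t ^ (m + 1) * ‖x‖) ^ 2 = K ^ 2 * t ^ (2 * m + 1) * ‖x‖ ^ 2 := by
      field_simp
      ring
    linarith
  rw [intervalIntegral.integral_sub (Continuous.intervalIntegrable (by fun_prop) _ _)
    (Continuous.intervalIntegrable (by fun_prop) _ _), intervalIntegral.integral_const_mul,
    intervalIntegral.integral_const, sub_zero, one_smul] at h2
  set J := ∫ s in (0 : ℝ)..1, ‖C (NormedSpace.exp (-((t * s) • B)) x)‖ ^ 2
  set I := ∫ s in (0 : ℝ)..1, ‖p s‖ ^ 2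
  have h3 := mul_le_mul_of_nonneg_left h1 (sub_nonneg.2 ht1)
  have h4 : 1 - (2 + β) * t ≤ (1 - t) * ((1 - t) * (1 - β * t)) := by
    have h40 : 0 ≤ β * t := by positivity
    nlinarith [mul_nonneg h40 ht.le, mul_nonneg (sq_nonneg t) (sub_nonneg.2 htβ)]
  have h5 : t ^ (2 * m) * ((1 - (2 + β) * t) * c) * ‖x‖ ^ 2 ≤
      t ^ (2 * m) * ((1 - t) * ((1 - t) * (1 - β * t)) * c) * ‖x‖ ^ 2 := by
    gcongr
  have h6 : t ^ (2 * m) * ((1 - (2 + β) * t) * c) * ‖x‖ ^ 2 -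
      K ^ 2 * t ^ (2 * m + 1) * ‖x‖ ^ 2 ≤ J := by
    nlinarith
  have h7 := mul_le_mul_of_nonneg_left h6 (show 0 ≤ 2 * t by positivity)
  calc _ ≤ _ := sub_le_sub_left h7 _
    _ = _ := by ring

/-- In the Taylor sum up to order `m - i`, every term but the last contains some `C B^k x` with `k <
m` and vanishes. -/
theorem exists_norm_exp_sub_le_of_mem_obsKer {B C : E →L[ℂ] E} {m i : ℕ} (hi : i ≤ m) {x : E}
    (hx : x ∈ obsKer B C m) :
    ∃ δ > (0 : ℝ), ∃ K ≥ (0 : ℝ), ∀ s : ℝ, 0 ≤ s → s < δ →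
      ‖C (NormedSpace.exp (-(s • B)) ((B ^ i) x)) -
        (s ^ (m - i) * ((-1) ^ (m - i) / (m - i).factorial) : ℝ) • C ((B ^ m) x)‖ ≤
      K * s ^ (m - i + 1) := by
  obtain ⟨δ, hδ, K, hK, h⟩ := exists_norm_exp_sub_sum_le B C (m - i)
  refine ⟨δ, hδ, K * ‖(B ^ i) x‖, by positivity, fun s hs0 hs => ?_⟩
  have h1 := h s hs0 hs ((B ^ i) x)
  have e : ∀ j, (B ^ j) ((B ^ i) x) = (B ^ (j + i)) x := fun j => by rw [pow_add]; rfl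
  simp only [e] at h1
  rw [Finset.sum_range_succ, Finset.sum_eq_zero, zero_add, Nat.sub_add_cancel hi, smul_smul] at h1
  · refine h1.trans_eq ?_
    ring
  · intro j hj
    rw [mem_obsKer.1 hx (j + i) (by have := Finset.mem_range.1 hj; omega), smul_zero, smul_zero]

/-- The test vectors `∑ i ≤ m, t ^ i • α i • B ^ i x`, with coefficients `α` coming from the
shifted Legendre polynomial, realise the optimal leading order of the dissipated energy. -/
theorem exists_integral_le {B C : E →L[ℂ] E} {m : ℕ} {x : E} (hx : x ∈ obsKer B C m) :
    ∃ ε > (0 : ℝ), ∃ K ≥ (0 : ℝ), ∀ t, 0 < t → t < ε → ∃ y : E, ‖y - x‖ ≤ K * t ∧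
      ∫ s in (0 : ℝ)..1, ‖C (NormedSpace.exp (-((t * s) • B)) y)‖ ^ 2 ≤
        legendreConst m / m.factorial ^ 2 * ‖C ((B ^ m) x)‖ ^ 2 * t ^ (2 * m) +
          K * t ^ (2 * m + 1) := by
  obtain ⟨L, hdeg, hlead, horth, hself⟩ := exists_monic_shiftedLegendre m
  have hLL := integral_eval_sq_eq hdeg hlead horth hself
  have hm : (m.factorial : ℝ) ≠ 0 := by exact_mod_cast m.factorial_ne_zero
  choose! δ hδ K hK hδK using fun (i : ℕ) (hi : i ≤ m) =>
    exists_norm_exp_sub_le_of_mem_obsKer hi hx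
  obtain ⟨A, hA⟩ := isCompact_Icc.exists_bound_of_continuousOn (s := Set.Icc (0 : ℝ) 1)
    (f := fun s => (L.eval s / m.factorial) • C ((B ^ m) x))
    (Continuous.continuousOn (by fun_prop))
  have hA0 : 0 ≤ A := (norm_nonneg _).trans (hA 0 (Set.left_mem_Icc.2 zero_le_one))
  -- To leading order the `i`-th summand contributes `t^m α_i (-s)^(m-i)/(m-i)! · C B^m x`. These
  -- coefficients turn the sum into `(-t)^m L(s)/m! · C B^m x`; since `L` is monic, `α 0 = 1` and
  -- the test vector is `x + O(t)`.
  set α : ℕ → ℝ := fun i => L.coeff (m - i) * ((-1) ^ i * (m - i).factorial / m.factorial) with hα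
  have hα0 : α 0 = 1 := by simp [hα, hlead, hm]
  set R := ∑ i ∈ Finset.range (m + 1), |α i| * K i with hR
  have hR0 : 0 ≤ R := Finset.sum_nonneg fun i hi =>
    mul_nonneg (abs_nonneg _) (hK i (Nat.lt_succ_iff.1 (Finset.mem_range.1 hi)))
  set Q := ∑ i ∈ Finset.range m, |α (i + 1)| * ‖(B ^ (i + 1)) x‖ with hQ
  have hQ0 : 0 ≤ Q := by positivity
  have hne : (Finset.range (m + 1)).Nonempty := ⟨0, by simp⟩
  refine ⟨min 1 ((Finset.range (m + 1)).inf' hne δ), lt_min one_pos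
    ((Finset.lt_inf'_iff hne).2 fun i hi => hδ i (Nat.lt_succ_iff.1 (Finset.mem_range.1 hi))),
    Q + (2 * A * R + R ^ 2), by positivity, fun t ht htε => ?_⟩
  have ht1 : t ≤ 1 := (htε.trans_le (min_le_left _ _)).le
  have htδ : ∀ i ≤ m, t < δ i := fun i hi =>
    (Finset.lt_inf'_iff hne).1 (htε.trans_le (min_le_right _ _)) i
      (Finset.mem_range.2 (Nat.lt_succ_of_le hi))
  refine ⟨∑ i ∈ Finset.range (m + 1), (t ^ i * α i) • (B ^ i) x, ?_, ?_⟩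
  · rw [Finset.sum_range_succ', pow_zero, hα0, one_mul, pow_zero, one_smul,
      one_apply_eq_self, add_sub_cancel_right]
    calc _ ≤ ∑ i ∈ Finset.range m, ‖(t ^ (i + 1) * α (i + 1)) • (B ^ (i + 1)) x‖ :=
          norm_sum_le _ _
      _ ≤ ∑ i ∈ Finset.range m, |α (i + 1)| * ‖(B ^ (i + 1)) x‖ * t := by
        refine Finset.sum_le_sum fun i _ => ?_
        rw [norm_smul, norm_mul, norm_pow, Real.norm_of_nonneg ht.le, Real.norm_eq_abs, pow_succ]
        have h1 : t ^ i ≤ 1 := pow_le_one₀ ht.le ht1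
        have h2 : 0 ≤ |α (i + 1)| * ‖(B ^ (i + 1)) x‖ * t := by positivity
        calc _ = t ^ i * (|α (i + 1)| * ‖(B ^ (i + 1)) x‖ * t) := by ring
          _ ≤ _ := mul_le_of_le_one_left h2 h1
      _ = Q * t := by rw [← Finset.sum_mul]
      _ ≤ _ := by gcongr; exact le_add_of_nonneg_right (by positivity)
  · set y := ∑ i ∈ Finset.range (m + 1), (t ^ i * α i) • (B ^ i) x with hy
    have hfc : Continuous fun s : ℝ => C (NormedSpace.exp (-((t * s) • B)) y) :=
      C.continuous.comp ((continuous_exp_neg_smul_apply B y).comp (continuous_const_mul t))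
    have hpt : ∀ s ∈ Set.Icc (0 : ℝ) 1, ‖C (NormedSpace.exp (-((t * s) • B)) y)‖ ^ 2 ≤
        ‖C ((B ^ m) x)‖ ^ 2 / (m.factorial : ℝ) ^ 2 * t ^ (2 * m) * L.eval s ^ 2 +
          (2 * A * R + R ^ 2) * t ^ (2 * m + 1) := by
      intro s hs
      have hts0 : 0 ≤ t * s := mul_nonneg ht.le hs.1
      have hts : t * s ≤ t := mul_le_of_le_one_right ht.le hs.2
      have hCy : C (NormedSpace.exp (-((t * s) • B)) y) = ∑ i ∈ Finset.range (m + 1),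
          (t ^ i * α i) • C (NormedSpace.exp (-((t * s) • B)) ((B ^ i) x)) := by
        rw [hy, map_sum, map_sum]
        refine Finset.sum_congr rfl fun i _ => ?_
        rw [← Complex.coe_smul (t ^ i * α i) ((B ^ i) x), map_smul, map_smul, Complex.coe_smul]
      have hmain : t ^ m • ((-1 : ℝ) ^ m • ((L.eval s / m.factorial) • C ((B ^ m) x))) =
          ∑ i ∈ Finset.range (m + 1), (t ^ i * α i) •
            ((t * s) ^ (m - i) * ((-1) ^ (m - i) / (m - i).factorial) : ℝ) • C ((B ^ m) x) := by
        rw [Polynomial.eval_eq_sum_range' (Nat.lt_succ_of_le hdeg),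
          ← Finset.sum_range_reflect, smul_smul, smul_smul, Finset.sum_div, Finset.mul_sum,
          Finset.sum_smul]
        refine Finset.sum_congr rfl fun i hi => ?_
        have hi' := Nat.lt_succ_iff.1 (Finset.mem_range.1 hi)
        obtain ⟨k, rfl⟩ := Nat.exists_eq_add_of_le hi'
        have hk : (k.factorial : ℝ) ≠ 0 := by exact_mod_cast k.factorial_ne_zero
        simp only [hα, smul_smul, Nat.add_sub_cancel_left,
          show i + k + 1 - 1 - i = k by omega]
        congr 1
        field_simp
        ring
      have hrem : ‖C (NormedSpace.exp (-((t * s) • B)) y) -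
          t ^ m • ((-1 : ℝ) ^ m • ((L.eval s / m.factorial) • C ((B ^ m) x)))‖ ≤
          R * t ^ (m + 1) := by
        rw [hCy, hmain, ← Finset.sum_sub_distrib, hR, Finset.sum_mul]
        refine (norm_sum_le _ _).trans (Finset.sum_le_sum fun i hi => ?_)
        have hi' := Nat.lt_succ_iff.1 (Finset.mem_range.1 hi)
        rw [← smul_sub, norm_smul, norm_mul, norm_pow, Real.norm_of_nonneg ht.le,
          Real.norm_eq_abs]
        have h1 := hδK i hi' (t * s) hts0 (hts.trans_lt (htδ i hi'))
        have h2 : K i * (t * s) ^ (m - i + 1) ≤ K i * t ^ (m - i + 1) := by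
          have := hK i hi'
          gcongr
        calc _ ≤ t ^ i * |α i| * (K i * t ^ (m - i + 1)) := by
              gcongr
              exact h1.trans h2
          _ = |α i| * K i * (t ^ i * t ^ (m - i + 1)) := by ring
          _ = _ := by
              rw [← pow_add]
              congr 2
              omega
      have hnorm : ‖t ^ m • ((-1 : ℝ) ^ m • ((L.eval s / m.factorial) • C ((B ^ m) x)))‖ =
          t ^ m * ‖(L.eval s / m.factorial) • C ((B ^ m) x)‖ := by
        rw [norm_smul, norm_smul, norm_pow, norm_pow, norm_neg, norm_one, one_pow, one_mul,
          Real.norm_of_nonneg ht.le]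
      have hle : ‖C (NormedSpace.exp (-((t * s) • B)) y)‖ ≤
          t ^ m * ‖(L.eval s / m.factorial) • C ((B ^ m) x)‖ + R * t ^ (m + 1) := by
        rw [← hnorm]
        have := norm_sub_norm_le (C (NormedSpace.exp (-((t * s) • B)) y))
          (t ^ m • ((-1 : ℝ) ^ m • ((L.eval s / m.factorial) • C ((B ^ m) x))))
        linarith
      have hN2 : ‖(L.eval s / m.factorial) • C ((B ^ m) x)‖ ^ 2 =
          ‖C ((B ^ m) x)‖ ^ 2 / (m.factorial : ℝ) ^ 2 * L.eval s ^ 2 := by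
        rw [norm_smul, mul_pow, Real.norm_eq_abs, sq_abs]
        ring
      have hAs := hA s hs
      set N := ‖(L.eval s / m.factorial) • C ((B ^ m) x)‖
      have hN0 : 0 ≤ N := norm_nonneg _
      have hT : t ^ (2 * m + 1) * t ≤ t ^ (2 * m + 1) :=
        mul_le_of_le_one_right (by positivity) ht1
      have h3 := mul_le_mul_of_nonneg_left hT (sq_nonneg R)
      have h4 : 2 * N * R * t ^ (2 * m + 1) ≤ 2 * A * R * t ^ (2 * m + 1) := by gcongr
      calc _ ≤ (t ^ m * N + R * t ^ (m + 1)) ^ 2 := pow_le_pow_left₀ (norm_nonneg _) hle 2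
        _ = N ^ 2 * t ^ (2 * m) + 2 * N * R * t ^ (2 * m + 1) +
            R ^ 2 * (t ^ (2 * m + 1) * t) := by ring
        _ ≤ N ^ 2 * t ^ (2 * m) + 2 * A * R * t ^ (2 * m + 1) + R ^ 2 * t ^ (2 * m + 1) := by
          linarith
        _ = _ := by rw [hN2]; ring
    have hint := intervalIntegral.integral_mono_on zero_le_one
      ((hfc.norm.pow 2).intervalIntegrable (μ := MeasureTheory.volume) 0 1)
      (Continuous.intervalIntegrable (by fun_prop) _ _) hpt
    rw [intervalIntegral.integral_add (Continuous.intervalIntegrable (by fun_prop) _ _)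
      (Continuous.intervalIntegrable (by fun_prop) _ _), intervalIntegral.integral_const_mul, hLL,
      intervalIntegral.integral_const, sub_zero, one_smul] at hint
    refine hint.trans ?_
    have : 0 ≤ Q * t ^ (2 * m + 1) := by positivity
    calc _ = legendreConst m / m.factorial ^ 2 * ‖C ((B ^ m) x)‖ ^ 2 * t ^ (2 * m) +
          (2 * A * R + R ^ 2) * t ^ (2 * m + 1) := by ring
      _ ≤ _ := by linarith

theorem exists_le_norm_exp_sq {B C : E →L[ℂ] E} (hBC : ∀ x, (inner ℂ x (B x)).re = ‖C x‖ ^ 2)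
    {m : ℕ} {x : E} (hx : x ∈ obsKer B C m) (hx1 : ‖x‖ = 1) :
    ∃ ε > (0 : ℝ), ∃ M : ℝ, ∀ t, 0 < t → t < ε →
      1 - 2 * (legendreConst m / m.factorial ^ 2 * ‖C ((B ^ m) x)‖ ^ 2) * t ^ (2 * m + 1) -
          M * t ^ (2 * m + 2) ≤ ‖NormedSpace.exp (-(t • B))‖ ^ 2 := by
  obtain ⟨ε, hε, K, hK, h⟩ := exists_integral_le hx
  have hc0 : 0 ≤ legendreConst m / (m.factorial : ℝ) ^ 2 * ‖C ((B ^ m) x)‖ ^ 2 := by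
    have := legendreConst_pos m
    positivity
  set c := legendreConst m / (m.factorial : ℝ) ^ 2 * ‖C ((B ^ m) x)‖ ^ 2
  -- This ensures `K t ≤ 1/4`, hence `(1 + 4Kt)(1 - 2Kt) ≥ 1`, which bounds `1/‖y‖²` by `1 + 4Kt`.
  refine ⟨min 1 (min ε (1 / (4 * K + 1))), by positivity,
    2 * (K + 4 * K * c + 4 * K * K), fun t ht htε => ?_⟩
  have ht1 : t ≤ 1 := (htε.trans_le (min_le_left _ _)).le
  have htK : t * (4 * K + 1) ≤ 1 := by
    have := (htε.trans_le ((min_le_right _ _).trans (min_le_right _ _))).le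
    rwa [le_div_iff₀ (by positivity)] at this
  obtain ⟨y, hy, hint⟩ := h t ht (htε.trans_le ((min_le_right _ _).trans (min_le_left _ _)))
  have hKt : K * t ≤ 1 / 4 := by nlinarith
  have hKt0 : 0 ≤ K * t := by positivity
  have hy1 : 1 - K * t ≤ ‖y‖ := by
    have := norm_sub_norm_le x y
    rw [norm_sub_rev, hx1] at this
    linarith
  have hy2 : 1 - 2 * (K * t) ≤ ‖y‖ ^ 2 := by nlinarith
  have h1 := norm_exp_neg_smul_apply_sq hBC y t
  have h2 := pow_le_pow_left₀ (norm_nonneg _)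
    ((NormedSpace.exp (-(t • B))).le_opNorm y) 2
  rw [h1, mul_pow] at h2
  have h3 := mul_le_mul_of_nonneg_left hint (show 0 ≤ 2 * t by positivity)
  set P := ‖NormedSpace.exp (-(t • B))‖ ^ 2
  have hw : 0 < ‖y‖ ^ 2 := by nlinarith
  set w := ‖y‖ ^ 2
  have h4 : (1 - P) * w ≤ 2 * t * (c * t ^ (2 * m) + K * t ^ (2 * m + 1)) := by linarith
  have h5 : 1 ≤ (1 + 4 * (K * t)) * w := by nlinarith
  have h6 : 0 ≤ 2 * t * (c * t ^ (2 * m) + K * t ^ (2 * m + 1)) := by positivity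
  have h7 : 1 - P ≤ 2 * t * (c * t ^ (2 * m) + K * t ^ (2 * m + 1)) * (1 + 4 * (K * t)) := by
    rcases le_or_gt (1 - P) 0 with hP | hP
    · exact hP.trans (by positivity)
    · calc 1 - P ≤ (1 - P) * ((1 + 4 * (K * t)) * w) := le_mul_of_one_le_right hP.le h5
        _ = (1 - P) * w * (1 + 4 * (K * t)) := by ring
        _ ≤ _ := mul_le_mul_of_nonneg_right h4 (by positivity)
  have h8 : t ^ (2 * m + 2) * t ≤ t ^ (2 * m + 2) := mul_le_of_le_one_right (by positivity) ht1
  have h9 := mul_le_mul_of_nonneg_left h8 (show 0 ≤ 8 * K * K by positivity)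
  have h10 : 2 * t * (c * t ^ (2 * m) + K * t ^ (2 * m + 1)) * (1 + 4 * (K * t)) =
      2 * c * t ^ (2 * m + 1) + 2 * (K + 4 * K * c) * t ^ (2 * m + 2) +
        8 * K * K * (t ^ (2 * m + 2) * t) := by ring
  linarith

theorem exists_abs_norm_exp_sub_le {B C : E →L[ℂ] E}
    (hBC : ∀ x, (inner ℂ x (B x)).re = ‖C x‖ ^ 2) {m : ℕ} {x : E} (hx : x ∈ obsKer B C m)
    (hx1 : ‖x‖ = 1)
    (hmin : ∀ u ∈ obsKer B C m, ‖u‖ = 1 → ‖C ((B ^ m) x)‖ ^ 2 ≤ ‖C ((B ^ m) u)‖ ^ 2) :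
    ∃ ε > (0 : ℝ), ∃ M : ℝ, ∀ t, 0 < t → t < ε →
      |‖NormedSpace.exp (-(t • B))‖ -
        (1 - legendreConst m / m.factorial ^ 2 * ‖C ((B ^ m) x)‖ ^ 2 * t ^ (2 * m + 1))| ≤
      M * t ^ (2 * m + 2) := by
  -- Minimality on the unit sphere extends to the whole subspace by homogeneity.
  have hμ : ∀ u ∈ obsKer B C m, ‖C ((B ^ m) x)‖ ^ 2 * ‖u‖ ^ 2 ≤ ‖C ((B ^ m) u)‖ ^ 2 := by
    intro u hu
    rcases eq_or_ne u 0 with rfl | hu0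
    · simp
    have hn : 0 < ‖u‖ := norm_pos_iff.2 hu0
    have h := hmin (((‖u‖⁻¹ : ℝ) : ℂ) • u) (Submodule.smul_mem _ _ hu) (by
      rw [norm_smul, Complex.norm_real, norm_inv, norm_norm, inv_mul_cancel₀ hn.ne'])
    rw [map_smul, map_smul, norm_smul, Complex.norm_real, norm_inv, norm_norm, mul_pow, inv_pow,
      inv_mul_eq_div, le_div_iff₀ (by positivity)] at h
    exact h
  obtain ⟨ε₁, hε₁, M₁, h₁⟩ := exists_norm_exp_sq_le hBC m (sq_nonneg _) hμ
  obtain ⟨ε₂, hε₂, M₂, h₂⟩ := exists_le_norm_exp_sq hBC hx hx1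
  have hc0 : 0 ≤ legendreConst m / (m.factorial : ℝ) ^ 2 * ‖C ((B ^ m) x)‖ ^ 2 := by
    have := legendreConst_pos m
    positivity
  set c := legendreConst m / (m.factorial : ℝ) ^ 2 * ‖C ((B ^ m) x)‖ ^ 2
  refine ⟨min (min ε₁ ε₂) (min 1 (1 / (2 * c + 1))), by positivity, 2 * (|M₁| + |M₂| + c ^ 2),
    fun t ht htε => ?_⟩
  have ht1 : t ≤ 1 := (htε.trans_le ((min_le_right _ _).trans (min_le_left _ _))).le
  have htc : t * (2 * c + 1) ≤ 1 := by
    have := (htε.trans_le ((min_le_right _ _).trans (min_le_right _ _))).le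
    rwa [le_div_iff₀ (by positivity)] at this
  have hub := h₁ t ht (htε.trans_le ((min_le_left _ _).trans (min_le_left _ _)))
  have hlb := h₂ t ht (htε.trans_le ((min_le_left _ _).trans (min_le_right _ _)))
  set D := 1 - 2 * c * t ^ (2 * m + 1) + M₁ * t ^ (2 * m + 2)
  have hD : 0 ≤ D := by
    have := (sq_nonneg _).trans (hub x)
    rwa [hx1, one_pow, mul_one] at this
  have hP : ‖NormedSpace.exp (-(t • B))‖ ^ 2 ≤ D := by
    have h : ‖NormedSpace.exp (-(t • B))‖ ≤ √D := by
      refine ContinuousLinearMap.opNorm_le_bound _ (Real.sqrt_nonneg _) fun y => ?_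
      rw [← Real.sqrt_sq (norm_nonneg y), ← Real.sqrt_mul hD]
      exact Real.le_sqrt_of_sq_le (hub y)
    exact (pow_le_pow_left₀ (norm_nonneg _) h 2).trans_eq (Real.sq_sqrt hD)
  have hp0 := norm_nonneg (NormedSpace.exp (-(t • B)))
  set P := ‖NormedSpace.exp (-(t • B))‖
  have hT : 0 ≤ t ^ (2 * m + 2) := by positivity
  have hct : c * t ^ (2 * m + 1) ≤ 1 / 2 := by
    have : t ^ (2 * m + 1) ≤ t := by
      rw [pow_succ]
      exact mul_le_of_le_one_left ht.le (pow_le_one₀ ht.le ht1)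
    nlinarith
  have hq : (c * t ^ (2 * m + 1)) ^ 2 ≤ c ^ 2 * t ^ (2 * m + 2) := by
    rw [mul_pow, ← pow_mul]
    gcongr ?_ * ?_
    exact pow_le_pow_of_le_one ht.le ht1 (by omega)
  have hM₁ := mul_le_mul_of_nonneg_right (le_abs_self M₁) hT
  have hM₂ := mul_le_mul_of_nonneg_right (le_abs_self M₂) hT
  have hM₁' : 0 ≤ |M₁| * t ^ (2 * m + 2) := by positivity
  have hM₂' : 0 ≤ |M₂| * t ^ (2 * m + 2) := by positivity
  set q := c * t ^ (2 * m + 1) with hqdef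
  have hsq : |P ^ 2 - (1 - q) ^ 2| ≤ (|M₁| + |M₂| + c ^ 2) * t ^ (2 * m + 2) := by
    rw [abs_le]
    constructor <;> nlinarith [sq_nonneg q]
  -- Passing from squares to norms: the factor `P + (1 - q)` is at least `1/2` because `q ≤ 1/2`.
  have hfac : |P ^ 2 - (1 - q) ^ 2| = |P - (1 - q)| * (P + (1 - q)) := by
    rw [← abs_of_nonneg (show 0 ≤ P + (1 - q) by linarith), ← abs_mul]
    congr 1
    ring
  have hhalf : |P - (1 - q)| * (1 / 2) ≤ |P - (1 - q)| * (P + (1 - q)) :=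
    mul_le_mul_of_nonneg_left (by linarith) (abs_nonneg _)
  linarith

end Expansion

/-! ### Kernel chains and eigenvectors -/

section Operators

variable {E : Type*} [NormedAddCommGroup E] [InnerProductSpace ℂ E]

theorem obsKer_antitone (B C : E →L[ℂ] E) : Antitone (obsKer B C) := fun _ _ hkl _ hx =>
  mem_obsKer.2 fun j hj => mem_obsKer.1 hx j (hj.trans_le hkl)

/-- The iterates `B^j x` with `j < m` lie in `ker C`, where the two operators agree, so the equality
persists up to and including the power `m`. -/
theorem pow_apply_eq_of_forall_lt {A B C : E →L[ℂ] E} (h : ∀ x, C x = 0 → B x = A x) {m : ℕ}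
    {x : E} (hx : x ∈ obsKer B C m) : ∀ j ≤ m, (B ^ j) x = (A ^ j) x := by
  intro j
  induction j with
  | zero => simp
  | succ j ih =>
    intro hj
    rw [pow_succ', pow_succ', mul_apply_eq_comp, mul_apply_eq_comp,
      ← ih (by omega)]
    exact h _ (mem_obsKer.1 hx j hj)

theorem obsKer_congr {A B C : E →L[ℂ] E} (h : ∀ x, C x = 0 → B x = A x) (m : ℕ) :
    obsKer B C m = obsKer A C m := by
  apply le_antisymm
  · intro x hx
    refine mem_obsKer.2 fun j hj => ?_
    rw [← pow_apply_eq_of_forall_lt h hx j hj.le]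
    exact mem_obsKer.1 hx j hj
  · intro x hx
    refine mem_obsKer.2 fun j hj => ?_
    rw [← pow_apply_eq_of_forall_lt (fun x hx => (h x hx).symm) hx j hj.le]
    exact mem_obsKer.1 hx j hj

/-- The decreasing chain of kernels stabilises, and its limit is `B`-invariant and inside `ker C`;
if nonzero it would contain a forbidden eigenvector. -/
theorem exists_obsKer_eq_bot [FiniteDimensional ℂ E] {B C : E →L[ℂ] E}
    (h : ∀ (z : ℂ) (x : E), B x = z • x → C x = 0 → x = 0) : ∃ m, obsKer B C m = ⊥ := by
  obtain ⟨m, hm⟩ := IsArtinian.monotone_stabilizes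
    (⟨obsKer B C, obsKer_antitone B C⟩ : ℕ →o (Submodule ℂ E)ᵒᵈ)
  replace hm : ∀ k, m ≤ k → obsKer B C m = obsKer B C k := hm
  refine ⟨m, ?_⟩
  by_contra hne
  have hinv : ∀ x ∈ obsKer B C m, B x ∈ obsKer B C m := by
    intro x hx
    rw [hm (m + 1) (Nat.le_succ m)] at hx
    refine mem_obsKer.2 fun j hj => ?_
    have := mem_obsKer.1 hx (j + 1) (by omega)
    rwa [pow_succ] at this
  have : Nontrivial (obsKer B C m) := Submodule.nontrivial_iff_ne_bot.2 hne
  obtain ⟨z, hz⟩ := Module.End.exists_eigenvalue (B.toLinearMap.restrict hinv)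
  obtain ⟨⟨x, hxm⟩, hx⟩ := hz.exists_hasEigenvector
  refine hx.2 (Subtype.ext (h z x (congrArg Subtype.val hx.apply_eq_smul) ?_))
  rw [hm (m + 1) (Nat.le_succ m)] at hxm
  simpa using mem_obsKer.1 hxm 0 (Nat.succ_pos m)

theorem exp_apply_of_apply_eq_smul [CompleteSpace E] {Y : E →L[ℂ] E} {z : ℂ} {x : E}
    (h : Y x = z • x) : NormedSpace.exp Y x = Complex.exp z • x := by
  have hpow : ∀ k : ℕ, (Y ^ k) x = z ^ k • x := by
    intro k
    induction k with
    | zero => simp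
    | succ k ih =>
      rw [pow_succ, mul_apply_eq_comp, h, map_smul, ih, smul_smul, pow_succ']
  have h1 := (NormedSpace.exp_series_hasSum_exp' (𝕂 := ℂ) Y).mapL
    (ContinuousLinearMap.apply ℂ E x)
  have h2 := (NormedSpace.exp_series_hasSum_exp' (𝕂 := ℂ) z).smul_const x
  rw [Complex.exp_eq_exp_ℂ]
  refine h1.unique ?_
  convert h2 using 2 with k
  simp [hpow, smul_smul]

end Operators

/-! ### Uniqueness of the leading term -/

/-- Subtract the two expansions, divide by `t^a` and let `t → 0+`: the limit is `c - c'` if `a =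
a'`, and `c` if `a < a'`, and must be zero. -/
theorem shortTimeDecay_unique_of_le {f : ℝ → ℝ} {a a' c c' ε ε' M M' : ℝ} (haa : a ≤ a')
    (hc : 0 < c) (hε : 0 < ε) (hε' : 0 < ε')
    (h : ∀ t ∈ Set.Ico (0 : ℝ) ε, |f t - (1 - c * t ^ a)| ≤ M * t ^ (a + 1))
    (h' : ∀ t ∈ Set.Ico (0 : ℝ) ε', |f t - (1 - c' * t ^ a')| ≤ M' * t ^ (a' + 1)) :
    a = a' ∧ c = c' := by
  have hpow : ∀ p : ℝ, 0 < p → Filter.Tendsto (fun t : ℝ => t ^ p)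
      (nhdsWithin 0 (Set.Ioi 0)) (nhds 0) := by
    intro p hp
    have := (Real.continuousAt_rpow_const 0 p (Or.inr hp.le)).tendsto
    rw [Real.zero_rpow hp.ne'] at this
    exact this.mono_left nhdsWithin_le_nhds
  have hev : ∀ᶠ t in nhdsWithin (0 : ℝ) (Set.Ioi 0),
      |c - c' * t ^ (a' - a)| ≤ M * t ^ (1 : ℝ) + M' * t ^ (a' - a + 1) := by
    filter_upwards [Ioo_mem_nhdsGT (lt_min hε hε')] with t ht
    have h1 := h t ⟨ht.1.le, ht.2.trans_le (min_le_left _ _)⟩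
    have h2 := h' t ⟨ht.1.le, ht.2.trans_le (min_le_right _ _)⟩
    have hta : 0 < t ^ a := Real.rpow_pos_of_pos ht.1 a
    have e1 : t ^ a' = t ^ a * t ^ (a' - a) := by
      rw [← Real.rpow_add ht.1]; congr 1; ring
    have e2 : t ^ (a + 1) = t ^ a * t ^ (1 : ℝ) := Real.rpow_add ht.1 _ _
    have e3 : t ^ (a' + 1) = t ^ a * t ^ (a' - a + 1) := by
      rw [← Real.rpow_add ht.1]; congr 1; ring
    have h3 : |c * t ^ a - c' * t ^ a'| ≤ M * t ^ (a + 1) + M' * t ^ (a' + 1) := by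
      refine le_trans ?_ (add_le_add h1 h2)
      refine le_trans (le_of_eq ?_) (abs_sub _ _)
      congr 1
      ring
    have h4 : |c * t ^ a - c' * t ^ a'| = t ^ a * |c - c' * t ^ (a' - a)| := by
      rw [← abs_of_pos hta, ← abs_mul, abs_of_pos hta, e1]
      congr 1
      ring
    rw [h4, e2, e3] at h3
    refine le_of_mul_le_mul_left (h3.trans_eq ?_) hta
    ring
  have hrhs : Filter.Tendsto (fun t : ℝ => M * t ^ (1 : ℝ) + M' * t ^ (a' - a + 1))
      (nhdsWithin 0 (Set.Ioi 0)) (nhds 0) := by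
    simpa using ((hpow 1 one_pos).const_mul M).add
      ((hpow (a' - a + 1) (by linarith)).const_mul M')
  rcases haa.eq_or_lt with rfl | hlt
  · refine ⟨rfl, ?_⟩
    simp only [sub_self, Real.rpow_zero, mul_one] at hev hrhs
    have := ge_of_tendsto hrhs hev
    exact sub_eq_zero.1 (abs_nonpos_iff.1 this)
  · exfalso
    have hl : Filter.Tendsto (fun t : ℝ => |c - c' * t ^ (a' - a)|)
        (nhdsWithin 0 (Set.Ioi 0)) (nhds |c - c' * 0|) :=
      (((hpow (a' - a) (by linarith)).const_mul c').const_sub c).abs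
    have := le_of_tendsto_of_tendsto hl hrhs hev
    rw [mul_zero, sub_zero, abs_of_pos hc] at this
    linarith

theorem HasShortTimeDecay.unique {n : ℕ} {B : Matrix (Fin n) (Fin n) ℂ} {a a' c c' : ℝ}
    (hc : 0 < c) (hc' : 0 < c') (h : HasShortTimeDecay B a c) (h' : HasShortTimeDecay B a' c') :
    a = a' ∧ c = c' := by
  obtain ⟨ε, hε, M, h⟩ := h
  obtain ⟨ε', hε', M', h'⟩ := h'
  rcases le_total a a' with haa | haa
  · exact shortTimeDecay_unique_of_le haa hc hε hε' h h'
  · exact (shortTimeDecay_unique_of_le haa hc' hε' hε h' h).imp Eq.symm Eq.symm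

/-! ### Translation between matrices and operators -/

section Matrices

open Matrix
open scoped ComplexOrder

variable {n : ℕ}

theorem toEuclideanLin_apply_eq (M : Matrix (Fin n) (Fin n) ℂ) (x : EuclideanSpace ℂ (Fin n)) :
    toEuclideanLin M x = toEuclideanCLM (n := Fin n) (𝕜 := ℂ) M x := by
  rw [← coe_toEuclideanCLM_eq_toEuclideanLin]
  rfl

theorem inner_conjTranspose_mul_self (D : Matrix (Fin n) (Fin n) ℂ)
    (x : EuclideanSpace ℂ (Fin n)) :
    inner ℂ x (toEuclideanCLM (n := Fin n) (𝕜 := ℂ) (Dᴴ * D) x) =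
      (‖toEuclideanCLM (n := Fin n) (𝕜 := ℂ) D x‖ : ℂ) ^ 2 := by
  rw [← star_eq_conjTranspose, map_mul, map_star, mul_apply_eq_comp,
    ContinuousLinearMap.star_eq_adjoint, ContinuousLinearMap.adjoint_inner_right,
    inner_self_eq_norm_sq_to_K]
  rfl

theorem quadForm_conjTranspose_mul_self (D : Matrix (Fin n) (Fin n) ℂ)
    (x : EuclideanSpace ℂ (Fin n)) :
    quadForm (Dᴴ * D) x = ‖toEuclideanCLM (n := Fin n) (𝕜 := ℂ) D x‖ ^ 2 := by
  rw [quadForm, toEuclideanLin_apply_eq, inner_conjTranspose_mul_self, ← Complex.ofReal_pow,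
    Complex.ofReal_re]

theorem sum_conjTranspose_mul_self_apply_eq_zero (s : Finset ℕ)
    (D : ℕ → Matrix (Fin n) (Fin n) ℂ) (x : EuclideanSpace ℂ (Fin n)) :
    toEuclideanCLM (n := Fin n) (𝕜 := ℂ) (∑ j ∈ s, (D j)ᴴ * D j) x = 0 ↔
      ∀ j ∈ s, toEuclideanCLM (n := Fin n) (𝕜 := ℂ) (D j) x = 0 := by
  constructor
  · intro h
    have h1 : (inner ℂ x (toEuclideanCLM (n := Fin n) (𝕜 := ℂ)
        (∑ j ∈ s, (D j)ᴴ * D j) x)) = 0 := by rw [h, inner_zero_right]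
    rw [map_sum, _root_.sum_apply, inner_sum] at h1
    simp only [inner_conjTranspose_mul_self, ← Complex.ofReal_pow] at h1
    rw [← Complex.ofReal_sum, Complex.ofReal_eq_zero,
      Finset.sum_eq_zero_iff_of_nonneg fun _ _ => by positivity] at h1
    intro j hj
    simpa using h1 j hj
  · intro h
    rw [map_sum, _root_.sum_apply]
    refine Finset.sum_eq_zero fun j hj => ?_
    rw [map_mul, mul_apply_eq_comp, h j hj, map_zero]

theorem posDef_sum_conjTranspose_mul_self_iff (s : Finset ℕ)
    (D : ℕ → Matrix (Fin n) (Fin n) ℂ) :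
    (∑ j ∈ s, (D j)ᴴ * D j).PosDef ↔ ∀ x, (∀ j ∈ s,
      toEuclideanCLM (n := Fin n) (𝕜 := ℂ) (D j) x = 0) → x = 0 := by
  have hpsd : (∑ j ∈ s, (D j)ᴴ * D j).PosSemidef :=
    posSemidef_sum _ fun j _ => posSemidef_conjTranspose_mul_self (D j)
  rw [hpsd.posDef_iff_isUnit, ← mulVec_injective_iff_isUnit, ← coe_mulVecLin,
    ← LinearMap.ker_eq_bot, LinearMap.ker_eq_bot']
  simp only [← sum_conjTranspose_mul_self_apply_eq_zero]
  constructor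
  · intro h x hx
    have := h x.ofLp (by
      rw [mulVecLin_apply, ← ofLp_toEuclideanCLM, hx]
      rfl)
    ext i
    exact congrFun this i
  · intro h x hx
    have := h (WithLp.toLp 2 x) (by
      rw [toEuclideanCLM_toLp, ← mulVecLin_apply, hx]
      rfl)
    simpa using this

theorem exists_hermPart_eq_conjTranspose_mul_self {B : Matrix (Fin n) (Fin n) ℂ}
    (hB : IsPosConservativeDissipative B) : ∃ C, hermPart B = Cᴴ * C := by
  open scoped MatrixOrder Matrix.Norms.L2Operator in
  exact CStarAlgebra.nonneg_iff_eq_star_mul_self.mp (Matrix.PosSemidef.nonneg hB)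

theorem propagatorNorm_eq (B : Matrix (Fin n) (Fin n) ℂ) (t : ℝ) :
    propagatorNorm B t =
      ‖NormedSpace.exp (-(t • toEuclideanCLM (n := Fin n) (𝕜 := ℂ) B))‖ := by
  have h : toEuclideanCLM (n := Fin n) (𝕜 := ℂ) (NormedSpace.exp (-((t : ℂ) • B))) =
      NormedSpace.exp (toEuclideanCLM (n := Fin n) (𝕜 := ℂ) (-((t : ℂ) • B))) := by
    open scoped Matrix.Norms.L2Operator in
    let _ : NormedAlgebra ℚ (Matrix (Fin n) (Fin n) ℂ) := NormedAlgebra.restrictScalars ℚ ℂ _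
    exact NormedSpace.map_exp _
      (AddMonoidHomClass.isometry_of_norm (toEuclideanCLM (n := Fin n) (𝕜 := ℂ))
        fun _ => rfl).continuous _
  rw [propagatorNorm, h, map_neg, map_smul]
  rfl

end Matrices

/-! ### Index, spectrum and decay for matrices -/

section Matrices

open Matrix
open scoped ComplexOrder

variable {n : ℕ}

theorem hermPart_add_antiHermPart (B : Matrix (Fin n) (Fin n) ℂ) :
    hermPart B + antiHermPart B = B := by
  rw [hermPart, antiHermPart, ← smul_add, add_add_sub_cancel, ← two_smul ℂ B, smul_smul]
  norm_num

theorem conjTranspose_antiHermPart (B : Matrix (Fin n) (Fin n) ℂ) :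
    (antiHermPart B)ᴴ = -antiHermPart B := by
  rw [antiHermPart, conjTranspose_smul, conjTranspose_sub, conjTranspose_conjTranspose,
    ← smul_neg, neg_sub]
  simp

theorem re_inner_toEuclideanCLM (B : Matrix (Fin n) (Fin n) ℂ) (x : EuclideanSpace ℂ (Fin n)) :
    (inner ℂ x (toEuclideanCLM (n := Fin n) (𝕜 := ℂ) B x)).re = quadForm (hermPart B) x := by
  rw [quadForm, toEuclideanLin_apply_eq, hermPart, map_smul, map_add, ← star_eq_conjTranspose,
    map_star, ContinuousLinearMap.star_eq_adjoint, _root_.smul_apply, _root_.add_apply,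
    inner_smul_right, inner_add_right, ContinuousLinearMap.adjoint_inner_right,
    ← inner_conj_symm (toEuclideanCLM (n := Fin n) (𝕜 := ℂ) B x) x, Complex.add_conj]
  simp

theorem toEuclideanCLM_mul_pow_apply (C D : Matrix (Fin n) (Fin n) ℂ) (m : ℕ)
    (x : EuclideanSpace ℂ (Fin n)) :
    toEuclideanCLM (n := Fin n) (𝕜 := ℂ) (C * D ^ m) x =
      toEuclideanCLM (n := Fin n) (𝕜 := ℂ) C
        ((toEuclideanCLM (n := Fin n) (𝕜 := ℂ) D ^ m) x) := by
  rw [map_mul, map_pow, mul_apply_eq_comp]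

theorem conjTranspose_pow_mul_mul_pow (C D : Matrix (Fin n) (Fin n) ℂ) (m : ℕ) :
    Dᴴ ^ m * (Cᴴ * C) * D ^ m = (C * D ^ m)ᴴ * (C * D ^ m) := by
  rw [conjTranspose_mul, conjTranspose_pow]
  simp only [Matrix.mul_assoc]

theorem quadForm_conjTranspose_pow_mul_mul_pow (C D : Matrix (Fin n) (Fin n) ℂ) (m : ℕ)
    (x : EuclideanSpace ℂ (Fin n)) :
    quadForm (Dᴴ ^ m * (Cᴴ * C) * D ^ m) x = ‖toEuclideanCLM (n := Fin n) (𝕜 := ℂ) C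
        ((toEuclideanCLM (n := Fin n) (𝕜 := ℂ) D ^ m) x)‖ ^ 2 := by
  rw [conjTranspose_pow_mul_mul_pow, quadForm_conjTranspose_mul_self,
    toEuclideanCLM_mul_pow_apply]

variable {B C : Matrix (Fin n) (Fin n) ℂ}

theorem toEuclideanCLM_apply_eq_antiHermPart (hC : hermPart B = Cᴴ * C)
    (x : EuclideanSpace ℂ (Fin n)) (hx : toEuclideanCLM (n := Fin n) (𝕜 := ℂ) C x = 0) :
    toEuclideanCLM (n := Fin n) (𝕜 := ℂ) B x =
      toEuclideanCLM (n := Fin n) (𝕜 := ℂ) (antiHermPart B) x := by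
  conv_lhs => rw [← hermPart_add_antiHermPart B, hC, map_add, map_mul]
  rw [_root_.add_apply, mul_apply_eq_comp, hx, map_zero, zero_add]

theorem mem_unitKer_Ttt (hC : hermPart B = Cᴴ * C) (m : ℕ) (x : EuclideanSpace ℂ (Fin n)) :
    x ∈ unitKer (Ttt B m) ↔ x ∈ obsKer (toEuclideanCLM (n := Fin n) (𝕜 := ℂ) B)
      (toEuclideanCLM (n := Fin n) (𝕜 := ℂ) C) (m + 1) ∧ ‖x‖ = 1 := by
  have e : Ttt B m = ∑ j ∈ Finset.range (m + 1), (C * B ^ j)ᴴ * (C * B ^ j) := by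
    rw [Ttt, hC]
    simp only [conjTranspose_pow_mul_mul_pow]
  rw [unitKer, Set.mem_ofPred_eq, toEuclideanLin_apply_eq, e,
    sum_conjTranspose_mul_self_apply_eq_zero, mem_obsKer]
  simp only [toEuclideanCLM_mul_pow_apply, Finset.mem_range]

theorem posDef_T_iff (hC : hermPart B = Cᴴ * C) (m : ℕ) :
    (T B m).PosDef ↔ obsKer (toEuclideanCLM (n := Fin n) (𝕜 := ℂ) B)
      (toEuclideanCLM (n := Fin n) (𝕜 := ℂ) C) (m + 1) = ⊥ := by
  have e : T B m = ∑ j ∈ Finset.range (m + 1),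
      (C * antiHermPart B ^ j)ᴴ * (C * antiHermPart B ^ j) := by
    rw [T, hC]
    refine Finset.sum_congr rfl fun j _ => ?_
    -- `T` carries the adjoint on the right instead of the left; as `B_A* = -B_A`, exchanging the
    -- two costs the sign `(-1)^j` twice.
    rw [← conjTranspose_pow_mul_mul_pow, conjTranspose_antiHermPart, neg_pow]
    rcases neg_one_pow_eq_or (Matrix (Fin n) (Fin n) ℂ) j with h | h <;> simp [h]
  rw [e, posDef_sum_conjTranspose_mul_self_iff,
    obsKer_congr (toEuclideanCLM_apply_eq_antiHermPart hC), Submodule.eq_bot_iff]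
  simp only [toEuclideanCLM_mul_pow_apply, Finset.mem_range, mem_obsKer]

theorem hcIndex_ne_top_iff : hcIndex B ≠ ⊤ ↔ ∃ m, (T B m).PosDef := by
  simp [hcIndex, iInf_eq_top]

theorem exists_isLeast_of_hcIndex_ne_top (h : hcIndex B ≠ ⊤) :
    ∃ m, IsLeast {m | (T B m).PosDef} m := by
  classical
  have h' := hcIndex_ne_top_iff.1 h
  exact ⟨Nat.find h', Nat.find_spec h', fun _ hk => Nat.find_min' h' hk⟩

theorem hcIndex_eq_of_isLeast {m : ℕ} (h : IsLeast {m | (T B m).PosDef} m) : hcIndex B = m :=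
  le_antisymm (iInf₂_le m h.1) (le_iInf₂ fun _ hk => Nat.cast_le.2 (h.2 hk))

theorem exists_posDef_T_of_isHypocoercive (hC : hermPart B = Cᴴ * C) (h : IsHypocoercive B) :
    ∃ m, (T B m).PosDef := by
  obtain ⟨m, hm⟩ := exists_obsKer_eq_bot (B := toEuclideanCLM (n := Fin n) (𝕜 := ℂ) B)
    (C := toEuclideanCLM (n := Fin n) (𝕜 := ℂ) C) (fun z x hzx hx => by
      by_contra hx0
      have hz : z ∈ spectrum ℂ B := by
        rw [← AlgEquiv.spectrum_eq (toLinAlgEquiv (EuclideanSpace.basisFun (Fin n) ℂ).toBasis) B,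
          ← Module.End.hasEigenvalue_iff_mem_spectrum]
        refine Module.End.hasEigenvalue_of_hasEigenvector (x := x)
          (Module.End.hasEigenvector_iff.2 ⟨Module.End.mem_eigenspace_iff.2 ?_, hx0⟩)
        exact hzx
      -- For an eigenvector in `ker C` this identity reads `Re z · ‖x‖² = 0`, against
      -- hypocoercivity.
      have h1 := re_inner_toEuclideanCLM B x
      rw [hC, quadForm_conjTranspose_mul_self, hx, hzx, inner_smul_right,
        inner_self_eq_norm_sq_to_K] at h1
      have h2 := h z hz
      have h3 : 0 < ‖x‖ := norm_pos_iff.2 hx0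
      have h4 : (z * (‖x‖ : ℂ) ^ 2).re = z.re * ‖x‖ ^ 2 := by
        rw [← Complex.ofReal_pow, Complex.re_mul_ofReal]
      rw [norm_zero] at h1
      have h5 : z.re * ‖x‖ ^ 2 = 0 := by
        rw [← h4]
        simpa using h1
      have : 0 < z.re * ‖x‖ ^ 2 := by positivity
      exact this.ne' h5)
  exact ⟨m, (posDef_T_iff hC m).2 (le_bot_iff.1 (hm ▸ obsKer_antitone _ _ (Nat.le_succ m)))⟩

/-- At one small `t > 0` the propagator norm is below `1`; applied to an eigenvector this gives
`|e^{-tz}| < 1`. -/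
theorem HasShortTimeDecay.isHypocoercive {a c : ℝ} (hc : 0 < c)
    (h : HasShortTimeDecay B a c) : IsHypocoercive B := by
  obtain ⟨ε, hε, M, h⟩ := h
  have hpow : Filter.Tendsto (fun t : ℝ => M * t) (nhdsWithin 0 (Set.Ioi 0)) (nhds 0) := by
    have : Filter.Tendsto (fun t : ℝ => M * t) (nhds 0) (nhds (M * 0)) :=
      (continuous_const_mul M).tendsto 0
    rw [mul_zero] at this
    exact this.mono_left nhdsWithin_le_nhds
  obtain ⟨t, htM, ht⟩ := ((hpow.eventually (gt_mem_nhds hc)).and (Ioo_mem_nhdsGT hε)).exists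
  have hlt : propagatorNorm B t < 1 := by
    have h1 := (abs_le.1 (h t ⟨ht.1.le, ht.2⟩)).2
    have hta : 0 < t ^ a := Real.rpow_pos_of_pos ht.1 a
    rw [Real.rpow_add ht.1, Real.rpow_one] at h1
    nlinarith
  intro z hz
  rw [← AlgEquiv.spectrum_eq (toLinAlgEquiv (EuclideanSpace.basisFun (Fin n) ℂ).toBasis) B,
    ← Module.End.hasEigenvalue_iff_mem_spectrum] at hz
  obtain ⟨x, hx⟩ := hz.exists_hasEigenvector
  have hBx : toEuclideanCLM (n := Fin n) (𝕜 := ℂ) B x = z • x := hx.apply_eq_smul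
  have hexp := exp_apply_of_apply_eq_smul (Y := -(t • toEuclideanCLM (n := Fin n) (𝕜 := ℂ) B))
    (z := -(t * z)) (x := x) (by
      rw [_root_.neg_apply, _root_.smul_apply, hBx, neg_smul, mul_smul, Complex.coe_smul])
  have hle := (NormedSpace.exp (-(t • toEuclideanCLM (n := Fin n) (𝕜 := ℂ) B))).le_opNorm x
  rw [hexp, ← propagatorNorm_eq, norm_smul, Complex.norm_exp] at hle
  have hx0 : 0 < ‖x‖ := norm_pos_iff.2 hx.2
  have h2 := (le_of_mul_le_mul_right hle hx0).trans_lt hlt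
  rw [Real.exp_lt_one_iff] at h2
  simp only [Complex.neg_re, Complex.re_ofReal_mul] at h2
  exact pos_of_mul_pos_right (by linarith) ht.1.le

theorem exists_isMinOn_obsKer {E : Type*} [NormedAddCommGroup E] [InnerProductSpace ℂ E]
    [FiniteDimensional ℂ E] {B C : E →L[ℂ] E} {m : ℕ} (hne : obsKer B C m ≠ ⊥) :
    ∃ x ∈ obsKer B C m, ‖x‖ = 1 ∧
      ∀ u ∈ obsKer B C m, ‖u‖ = 1 → ‖C ((B ^ m) x)‖ ^ 2 ≤ ‖C ((B ^ m) u)‖ ^ 2 := by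
  have : ProperSpace E := FiniteDimensional.proper ℂ E
  have hcomp : IsCompact ((obsKer B C m : Set E) ∩ Metric.sphere 0 1) :=
    (isCompact_sphere 0 1).inter_left (Submodule.closed_of_finiteDimensional _)
  have hnon : ((obsKer B C m : Set E) ∩ Metric.sphere 0 1).Nonempty := by
    obtain ⟨y, hy, hy0⟩ := Submodule.exists_mem_ne_zero_of_ne_bot hne
    refine ⟨((‖y‖⁻¹ : ℝ) : ℂ) • y, Submodule.smul_mem _ _ hy, ?_⟩
    rw [mem_sphere_zero_iff_norm, norm_smul, Complex.norm_real, norm_inv, norm_norm,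
      inv_mul_cancel₀ (norm_ne_zero_iff.2 hy0)]
  obtain ⟨x, hx, hmin⟩ := hcomp.exists_isMinOn hnon
    (f := fun u => ‖C ((B ^ m) u)‖ ^ 2) (Continuous.continuousOn (by fun_prop))
  exact ⟨x, hx.1, by simpa using hx.2, fun u hu hu1 => hmin ⟨hu, by simpa using hu1⟩⟩

theorem legendreConst_div_factorial_sq (m : ℕ) :
    legendreConst m / (m.factorial : ℝ) ^ 2 =
      1 / ((Nat.factorial (2 * m + 1) : ℝ) * (Nat.choose (2 * m) m : ℝ)) := by
  have h2 : ((2 * m).choose m : ℝ) * m.factorial * m.factorial = (2 * m).factorial := by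
    have := Nat.choose_mul_factorial_mul_factorial (show m ≤ 2 * m by omega)
    rw [show 2 * m - m = m by omega] at this
    exact_mod_cast this
  rw [legendreConst, Nat.factorial_succ, div_div]
  push_cast
  rw [← h2]
  congr 1
  ring

theorem exists_hasShortTimeDecay (hn : 0 < n) (hC : hermPart B = Cᴴ * C) {m : ℕ}
    (hm : IsLeast {m | (T B m).PosDef} m) :
    ∃ x ∈ obsKer (toEuclideanCLM (n := Fin n) (𝕜 := ℂ) B)
      (toEuclideanCLM (n := Fin n) (𝕜 := ℂ) C) m, ‖x‖ = 1 ∧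
      (∀ u ∈ obsKer (toEuclideanCLM (n := Fin n) (𝕜 := ℂ) B)
        (toEuclideanCLM (n := Fin n) (𝕜 := ℂ) C) m, ‖u‖ = 1 →
        quadForm (Bᴴ ^ m * hermPart B * B ^ m) x ≤ quadForm (Bᴴ ^ m * hermPart B * B ^ m) u) ∧
      0 < 1 / ((Nat.factorial (2 * m + 1) : ℝ) * (Nat.choose (2 * m) m : ℝ)) *
        quadForm (Bᴴ ^ m * hermPart B * B ^ m) x ∧
      HasShortTimeDecay B (2 * m + 1)
        (1 / ((Nat.factorial (2 * m + 1) : ℝ) * (Nat.choose (2 * m) m : ℝ)) *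
          quadForm (Bᴴ ^ m * hermPart B * B ^ m) x) := by
  have : Nonempty (Fin n) := ⟨⟨0, hn⟩⟩
  simp only [hC, quadForm_conjTranspose_pow_mul_mul_pow, ← legendreConst_div_factorial_sq]
  have hBC : ∀ x, (inner ℂ x (toEuclideanCLM (n := Fin n) (𝕜 := ℂ) B x)).re =
      ‖toEuclideanCLM (n := Fin n) (𝕜 := ℂ) C x‖ ^ 2 := fun x => by
    rw [re_inner_toEuclideanCLM, hC, quadForm_conjTranspose_mul_self]
  have hbot := (posDef_T_iff hC m).1 hm.1
  have hlow : ∀ k < m, obsKer (toEuclideanCLM (n := Fin n) (𝕜 := ℂ) B)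
      (toEuclideanCLM (n := Fin n) (𝕜 := ℂ) C) (k + 1) ≠ ⊥ := fun k hk h =>
    absurd (hm.2 ((posDef_T_iff hC k).2 h)) (not_le.2 hk)
  have hprop := propagatorNorm_eq B
  set b := toEuclideanCLM (n := Fin n) (𝕜 := ℂ) B
  set k := toEuclideanCLM (n := Fin n) (𝕜 := ℂ) C
  -- For `m = 0` the kernel is the whole space, nonzero since `n > 0`; otherwise minimality of the
  -- index applies.
  have hne : obsKer b k m ≠ ⊥ := by
    cases m with
    | zero =>
      have : obsKer b k 0 = ⊤ := by simp [obsKer]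
      rw [this]
      exact top_ne_bot
    | succ l => exact hlow l (Nat.lt_succ_self l)
  obtain ⟨x, hx, hx1, hmin⟩ := exists_isMinOn_obsKer hne
  refine ⟨x, hx, hx1, hmin, ?_, ?_⟩
  · have hpos : 0 < ‖k ((b ^ m) x)‖ := by
      rw [norm_pos_iff]
      intro h0
      have hx' : x ∈ obsKer b k (m + 1) := mem_obsKer.2 fun j hj => by
        rcases (Nat.lt_succ_iff.1 hj).lt_or_eq with hj | rfl
        · exact mem_obsKer.1 hx j hj
        · exact h0
      rw [hbot, Submodule.mem_bot] at hx'
      simp [hx'] at hx1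
    have := legendreConst_pos m
    positivity
  · obtain ⟨ε, hε, M, h⟩ := exists_abs_norm_exp_sub_le hBC hx hx1 hmin
    refine ⟨ε, hε, M, fun t ht => ?_⟩
    have e1 : (2 * m + 1 : ℝ) = ((2 * m + 1 : ℕ) : ℝ) := by push_cast; ring
    have e2 : (2 * m + 1 : ℝ) + 1 = ((2 * m + 2 : ℕ) : ℝ) := by push_cast; ring
    rw [e2, e1, Real.rpow_natCast, Real.rpow_natCast, hprop]
    rcases ht.1.eq_or_lt with rfl | ht0
    · rw [zero_smul ℝ b, neg_zero, NormedSpace.exp_zero, norm_one]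
      simp
    · exact h t ht0 ht.2

end Matrices

end Hypocoercivity

/-! ### The main theorem -/

open Hypocoercivity Matrix in
theorem theorem2 (n : ℕ) (hn : 0 < n) (B : Matrix (Fin n) (Fin n) ℂ)
    (hB : IsPosConservativeDissipative B) :
    (IsHypocoercive B ↔ ∃ a c : ℝ, 0 < a ∧ 0 < c ∧ HasShortTimeDecay B a c) ∧
    (hcIndex B ≠ ⊤ ↔ ∃ a c : ℝ, 0 < a ∧ 0 < c ∧ HasShortTimeDecay B a c) ∧
    (∀ a c : ℝ, 0 < a → 0 < c → HasShortTimeDecay B a c →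
      ∃ m : ℕ, hcIndex B = m ∧ a = 2 * m + 1 ∧
        (1 ≤ m → ∃ μ : ℝ,
          IsLeast (quadForm (Bᴴ ^ m * hermPart B * B ^ m) '' unitKer (Ttt B (m - 1))) μ ∧
          IsLeast (quadForm ((antiHermPart B)ᴴ ^ m * hermPart B * antiHermPart B ^ m) ''
            unitKer (Ttt B (m - 1))) μ ∧
          c = 1 / ((Nat.factorial (2 * m + 1) : ℝ) * (Nat.choose (2 * m) m : ℝ)) * μ) ∧
        (m = 0 → IsLeast (quadForm (hermPart B) '' {x | ‖x‖ = 1}) c)) := by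
  obtain ⟨C, hC⟩ := exists_hermPart_eq_conjTranspose_mul_self hB
  have hdecay : hcIndex B ≠ ⊤ → ∃ a c : ℝ, 0 < a ∧ 0 < c ∧ HasShortTimeDecay B a c := by
    intro h
    obtain ⟨m, hm⟩ := exists_isLeast_of_hcIndex_ne_top h
    obtain ⟨x, -, -, -, hc, hdec⟩ := exists_hasShortTimeDecay hn hC hm
    exact ⟨_, _, by positivity, hc, hdec⟩
  have hhyp : (∃ a c : ℝ, 0 < a ∧ 0 < c ∧ HasShortTimeDecay B a c) → IsHypocoercive B :=
    fun ⟨_, _, _, hc, h⟩ => h.isHypocoercive hc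
  have hfin : IsHypocoercive B → hcIndex B ≠ ⊤ := fun h =>
    hcIndex_ne_top_iff.2 (exists_posDef_T_of_isHypocoercive hC h)
  refine ⟨⟨fun h => hdecay (hfin h), hhyp⟩, ⟨hdecay, fun h => hfin (hhyp h)⟩,
    fun a c ha hc h => ?_⟩
  obtain ⟨m, hm⟩ := exists_isLeast_of_hcIndex_ne_top (hfin (hhyp ⟨a, c, ha, hc, h⟩))
  obtain ⟨x, hx, hx1, hmin, hc', hdec⟩ := exists_hasShortTimeDecay hn hC hm
  -- Any given expansion must coincide with the constructed one.
  obtain ⟨rfl, hcc⟩ := h.unique hc hc' hdec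
  refine ⟨m, hcIndex_eq_of_isLeast hm, rfl, fun hm1 => ?_, ?_⟩
  · have hker : ∀ u, u ∈ unitKer (Ttt B (m - 1)) ↔
        u ∈ obsKer (toEuclideanCLM (n := Fin n) (𝕜 := ℂ) B)
          (toEuclideanCLM (n := Fin n) (𝕜 := ℂ) C) m ∧ ‖u‖ = 1 := fun u => by
      rw [mem_unitKer_Ttt hC, Nat.sub_add_cancel hm1]
    have hl : IsLeast (quadForm (Bᴴ ^ m * hermPart B * B ^ m) '' unitKer (Ttt B (m - 1)))
        (quadForm (Bᴴ ^ m * hermPart B * B ^ m) x) := by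
      refine ⟨⟨x, (hker x).2 ⟨hx, hx1⟩, rfl⟩, ?_⟩
      rintro _ ⟨u, hu, rfl⟩
      exact hmin u ((hker u).1 hu).1 ((hker u).1 hu).2
    refine ⟨_, hl, ?_, hcc⟩
    convert hl using 1
    -- On this kernel `B^m u = B_A^m u`, so the two quadratic forms have the same values.
    refine Set.image_congr fun u hu => ?_
    rw [hC, quadForm_conjTranspose_pow_mul_mul_pow, quadForm_conjTranspose_pow_mul_mul_pow,
      pow_apply_eq_of_forall_lt (toEuclideanCLM_apply_eq_antiHermPart hC) ((hker u).1 hu).1 m le_rfl]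
  · rintro rfl
    simp only [pow_zero, one_mul, mul_one] at hmin hcc
    have hcx : c = quadForm (hermPart B) x := by simpa using hcc
    refine ⟨⟨x, hx1, hcx.symm⟩, ?_⟩
    rintro _ ⟨u, hu, rfl⟩
    rw [hcx]
    exact hmin u (mem_obsKer.2 fun j hj => absurd hj (Nat.not_lt_zero j)) hu
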